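/- Let $\mathcal X$ be a set, $K,T\ge 0$ integers, $\mathcal S,\mathcal L\subseteq\mathbb R^K_+$, and let $\mathcal G$ be a nonempty class of functions $\mathcal X\to\mathcal S$. In each round $t=1,\dots,T$ of the full-information protocol the learner observes a context $x_t\in\mathcal X$ and chooses a probability distribution $p_t$ on $\mathcal S$, the adversary then reveals a loss vector $\ell_t\in\mathcal L$, and the learner samples $s_t\sim p_t$ and suffers the loss $\langle s_t,\ell_t\rangle$. An algorithm is a map which determines $p_t$ from $(x_1,\ell_1),\dots,(x_{t-1},\ell_{t-1}),x_t$. A $\mathcal Z$-valued tree $\mathbf z$ of length $T$ is a sequence of maps $\mathbf z_t:\{\pm1\}^{t-1}\to\mathcal Z$, $t=1,\dots,T$, and $\mathbf z_t(\epsilon)=\mathbf z_t(\epsilon_1,\dots,\epsilon_{t-1})$ for $\epsilon\in\{\pm1\}^T$. For an $\mathcal X$-valued tree $\mathbf x$ of length $T$, let $\mathcal N_{\infty,\infty}(\varepsilon,\mathcal G,\mathbf x)\in\mathbb N\cup\{\infty\}$ be the smallest cardinality of a set $V$ of $\mathbb R^K$-valued trees of length $T$ such that for all $g\in\mathcal G$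 and all $\epsilon\in\{\pm1\}^T$ there is $\mathbf v\in V$ with $\max_{t\le T}\|g(\mathbf x_t(\epsilon))-\mathbf v_t(\epsilon)\|_\infty\le\varepsilon$; let $\mathcal N_{\infty,\infty}(\varepsilon,\mathcal G,T)=\sup_{\mathbf x}\mathcal N_{\infty,\infty}(\varepsilon,\mathcal G,\mathbf x)$, the supremum being over all $\mathcal X$-valued trees of length $T$. **Theorem.** Let $R,B>0$, and assume $\|\ell\|_1\le R$ for all $\ell\in\mathcal L$ and $\|s\|_\infty\le B$ for all $s\in\mathcal S$. Fix any $\eta\in(0,1]$, $\lambda>0$ and $\beta>\alpha>0$. Then there exists an algorithm such that, for all sequences $x_1,\dots,x_T\in\mathcal X$ and $\ell_1,\dots,\ell_T\in\mathcal L$, $$ \begin{aligned} \sum_{t=1}^T\mathbb E_{s_t\sim p_t}\langle s_t,\ell_t\rangle-\inf_{g\in\mathcal G}\sum_{t=1}^T\langle g(x_t),\ell_t\rangle \le{}&\frac{2\eta}{RB}\sum_{t=1}^T\mathbb E_{s_t\sim p_t}\langle s_t,\ell_t\rangle^2+\frac{4RB}{\eta}\log\mathcal N_{\infty,\infty}(\beta/2,\mathcal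 G,T)+3e^2\alpha\sum_{t=1}^T\|\ell_t\|_1\\ &+24e\Big(\frac{\lambda}{4R}\sum_{t=1}^T\|\ell_t\|_1^2+\frac R\lambda\Big)\int_\alpha^\beta\sqrt{\log\mathcal N_{\infty,\infty}(\varepsilon,\mathcal G,T)}\,d\varepsilon , \end{aligned} $$ where the right-hand side is $+\infty$ (and the bound is trivial) if one of the entropy terms is infinite. -/

import Mathlib

open MeasureTheory
open scoped ENNReal Matrix

noncomputable section

namespace FullInfo

/-- A `Z`-valued tree of length `T`: the node at (zero-based) level `t` is labelled by a function of
the first `t` signs of a path. The sign set `{±1}` is represented by `Bool`. -/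
abbrev Tree (Z : Type*) (T : ℕ) : Type _ :=
  (t : Fin T) → (Fin (t : ℕ) → Bool) → Z

/-- The value of the tree `z` at level `t` on the path `e`. -/
def Tree.val {Z : Type*} {T : ℕ} (z : Tree Z T) (e : Fin T → Bool) (t : Fin T) : Z :=
  z t (fun i => e (Fin.castLE t.isLt.le i))

/-- `V` is a sequential cover of `G` on the tree `x` at scale `ε`, in the `L_∞/ℓ_∞` sense
(the norm of `Fin K → ℝ` is the sup-norm). -/
def IsSeqCover {X : Type*} {K T : ℕ} (ε : ℝ) (G : Set (X → Fin K → ℝ)) (x : Tree X T)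
    (V : Set (Tree (Fin K → ℝ) T)) : Prop :=
  ∀ g ∈ G, ∀ e : Fin T → Bool, ∃ v ∈ V, ∀ t : Fin T, ‖g (x.val e t) - v.val e t‖ ≤ ε

/-- The sequential covering number of `G` on the tree `x` at scale `ε`; it is `⊤` when there is no
finite cover. -/
def seqCoverNumOn {X : Type*} {K T : ℕ} (ε : ℝ) (G : Set (X → Fin K → ℝ)) (x : Tree X T) : ℕ∞ :=
  ⨅ (V : Set (Tree (Fin K → ℝ) T)) (_ : IsSeqCover ε G x V), V.encard

/-- The sequential covering number of `G` at scale `ε`: the supremum over all trees of length `T`. -/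
def seqCoverNum {X : Type*} {K : ℕ} (ε : ℝ) (G : Set (X → Fin K → ℝ)) (T : ℕ) : ℕ∞ :=
  ⨆ x : Tree X T, seqCoverNumOn ε G x

/-- The sequential metric entropy, the logarithm of the sequential covering number, with
`log ∞ = ∞`. -/
def seqEntropy {X : Type*} {K : ℕ} (ε : ℝ) (G : Set (X → Fin K → ℝ)) (T : ℕ) : ℝ≥0∞ :=
  (ENNReal.log ((seqCoverNum ε G T : ℕ∞) : ℝ≥0∞)).toENNReal

/-- The `ℓ₁`-norm on `ℝ^K`. -/
def l1norm {K : ℕ} (l : Fin K → ℝ) : ℝ := ∑ a, |l a|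

/-- An algorithm (strategy of the learner): from the contexts and losses of the `t` previous rounds
and the current context it produces a probability distribution on the outcome set `S`. -/
abbrev Algorithm (X : Type*) {K : ℕ} (S : Set (Fin K → ℝ)) : Type _ :=
  (t : ℕ) → (Fin t → X × (Fin K → ℝ)) → X → ProbabilityMeasure S

/-- The distribution `p_t` that the algorithm plays in round `t` against the contexts `x` and the
losses `l`. -/
def Algorithm.play {X : Type*} {K : ℕ} {S : Set (Fin K → ℝ)} (p : Algorithm X S) {T : ℕ}
    (x : Fin T → X) (l : Fin T → Fin K → ℝ) (t : Fin T) : ProbabilityMeasure S :=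
  p t (fun i => (x (Fin.castLE t.isLt.le i), l (Fin.castLE t.isLt.le i))) (x t)

/-- `∑_t E_{s_t ∼ p_t} ⟨s_t, ℓ_t⟩`. -/
def Algorithm.cumLoss {X : Type*} {K : ℕ} {S : Set (Fin K → ℝ)} (p : Algorithm X S) {T : ℕ}
    (x : Fin T → X) (l : Fin T → Fin K → ℝ) : ℝ :=
  ∑ t, ∫ s : S, ((s : Fin K → ℝ) ⬝ᵥ l t) ∂(p.play x l t : Measure S)

/-- `∑_t E_{s_t ∼ p_t} ⟨s_t, ℓ_t⟩²`. -/
def Algorithm.localNorm {X : Type*} {K : ℕ} {S : Set (Fin K → ℝ)} (p : Algorithm X S) {T : ℕ}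
    (x : Fin T → X) (l : Fin T → Fin K → ℝ) : ℝ :=
  ∑ t, ∫ s : S, ((s : Fin K → ℝ) ⬝ᵥ l t) ^ 2 ∂(p.play x l t : Measure S)

/-- The regret of the algorithm against the benchmark class `G`. -/
def Algorithm.regret {X : Type*} {K : ℕ} {S : Set (Fin K → ℝ)} (p : Algorithm X S)
    (G : Set (X → Fin K → ℝ)) {T : ℕ} (x : Fin T → X) (l : Fin T → Fin K → ℝ) : ℝ :=
  p.cumLoss x l - ⨅ g : G, ∑ t, ((g : X → Fin K → ℝ) (x t) ⬝ᵥ l t)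

end FullInfo

end

/-! The algorithm is not explicit. Each round is a zero-sum game between a distribution on `S` and
an outcome in `L`, solved up to `δ` by minimax, with `gameValue` as potential. The payoff is z - cz²
minus a penalty `ρ` of the outcome, where z is the learner's loss and c = 2η/(RB); the state records
the negated cumulative losses of the comparators. Against a known mixture of outcomes the learner
may imitate any g, and comparing with an independent copy of the outcome symmetrizes the game
(`exists_response`). The increment Z' - cZ'² - Z equals d(Z') - d(Z) - (c/2)(Z'² + Z²) with d(z) = z
- (c/2)z²: the antisymmetric part receives a random sign, the rest is a negative offset.

Unrolled, the value is a supremum of averages over sign paths of predictable processes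
(`functionals_eq_pathAvg`), which split into one process for each of the two outcomes. Each is
bounded by chaining over sequential covers (`pathAvg_offset_le`). The coarsest approximant is
dominated by Z, so the offset absorbs its variance and only entropy/c remains. The finer links cost
a dyadic entropy sum, at most twice the entropy integral, times a factor affine in the average of
∑‖o‖₁²; the last approximation error costs 4α∑‖o‖₁. The penalty `ρ` cancels exactly these
outcome-dependent terms, so the value depends on entropies only (`gameValue_le`), and `ρ` of the
actual losses reappears in the regret bound. -/

namespace FullInfo

/-! ### Averages over sign paths and the finite-class maximal inequality. -/

/-- The sign `±1` encoded by a Boolean. -/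
def sgn (b : Bool) : ℝ := if b then 1 else -1

/-- The average of a function over all sign paths of length `n`. -/
noncomputable def pathAvg (n : ℕ) (f : (Fin n → Bool) → ℝ) : ℝ := (∑ e, f e) / 2 ^ n

/-- A process on sign paths is predictable if its value at time `t` depends only on the signs
before `t`. -/
def Predictable {Z : Type*} {n : ℕ} (D : (Fin n → Bool) → Fin n → Z) : Prop :=
  ∀ e e' t, (∀ s, s < t → e s = e' s) → D e t = D e' t

theorem pathAvg_zero (f : (Fin 0 → Bool) → ℝ) : pathAvg 0 f = f Fin.elim0 := by
  simp [pathAvg, Subsingleton.elim _ Fin.elim0]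

theorem pathAvg_succ (n : ℕ) (f : (Fin (n + 1) → Bool) → ℝ) :
    pathAvg (n + 1) f = (pathAvg n (fun e => f (Fin.cons true e))
      + pathAvg n (fun e => f (Fin.cons false e))) / 2 := by
  unfold pathAvg
  rw [← (Fin.consEquiv (fun _ : Fin (n + 1) => Bool)).sum_comp f, Fintype.sum_prod_type,
    Fintype.sum_bool]
  simp only [Fin.consEquiv, Equiv.coe_fn_mk]
  rw [pow_succ]
  ring

theorem pathAvg_mono {n : ℕ} {f g : (Fin n → Bool) → ℝ} (h : ∀ e, f e ≤ g e) :
    pathAvg n f ≤ pathAvg n g := by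
  unfold pathAvg
  gcongr with e
  exact h e

theorem pathAvg_const (n : ℕ) (a : ℝ) : pathAvg n (fun _ => a) = a := by
  simp [pathAvg]

theorem pathAvg_add (n : ℕ) (f g : (Fin n → Bool) → ℝ) :
    pathAvg n (fun e => f e + g e) = pathAvg n f + pathAvg n g := by
  simp [pathAvg, Finset.sum_add_distrib, add_div]

theorem pathAvg_mul_left (n : ℕ) (a : ℝ) (f : (Fin n → Bool) → ℝ) :
    pathAvg n (fun e => a * f e) = a * pathAvg n f := by
  simp [pathAvg, ← Finset.mul_sum, mul_div_assoc]

theorem pathAvg_sub (n : ℕ) (f g : (Fin n → Bool) → ℝ) :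
    pathAvg n (fun e => f e - g e) = pathAvg n f - pathAvg n g := by
  simp [pathAvg, sub_div]

theorem pathAvg_sum (n : ℕ) {ι : Type*} (s : Finset ι) (f : ι → (Fin n → Bool) → ℝ) :
    pathAvg n (fun e => ∑ i ∈ s, f i e) = ∑ i ∈ s, pathAvg n (f i) := by
  simp only [pathAvg, Finset.sum_div]
  rw [Finset.sum_comm]

theorem pathAvg_nonneg {n : ℕ} {f : (Fin n → Bool) → ℝ} (h : ∀ e, 0 ≤ f e) :
    0 ≤ pathAvg n f :=
  div_nonneg (Finset.sum_nonneg fun e _ => h e) (by positivity)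

theorem exp_pathAvg_le (n : ℕ) (f : (Fin n → Bool) → ℝ) :
    Real.exp (pathAvg n f) ≤ pathAvg n (fun e => Real.exp (f e)) := by
  have := convexOn_exp.map_sum_le (t := Finset.univ) (w := fun _ : Fin n → Bool => 1 / (2 : ℝ) ^ n)
    (p := f) (fun _ _ => by positivity) (by simp) (fun _ _ => Set.mem_univ _)
  simpa [pathAvg, ← Finset.mul_sum, div_eq_inv_mul] using this

theorem Predictable.cons {Z : Type*} {n : ℕ} {D : (Fin (n + 1) → Bool) → Fin (n + 1) → Z}
    (hD : Predictable D) (b : Bool) :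
    Predictable fun (e : Fin n → Bool) t => D (Fin.cons b e) t.succ := by
  intro e e' t h
  refine hD _ _ _ fun s hs => ?_
  induction s using Fin.cases with
  | zero => simp
  | succ s => simpa using h s (Fin.succ_lt_succ_iff.1 hs)

theorem Predictable.map {Z W : Type*} {n : ℕ} {D : (Fin n → Bool) → Fin n → Z}
    (hD : Predictable D) (f : Z → W) : Predictable fun e t => f (D e t) :=
  fun e e' t h => congrArg f (hD e e' t h)

theorem Predictable.map₂ {Z W U : Type*} {n : ℕ} {D : (Fin n → Bool) → Fin n → Z}
    {E : (Fin n → Bool) → Fin n → W} (hD : Predictable D) (hE : Predictable E) (f : Z → W → U) :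
    Predictable fun e t => f (D e t) (E e t) :=
  fun e e' t h => by simp only [hD e e' t h, hE e e' t h]

theorem Tree.predictable_val {Z : Type*} {n : ℕ} (z : Tree Z n) :
    Predictable fun e t => z.val e t := by
  intro e e' t h
  exact congrArg (z t) (funext fun i => h _ (by simp [Fin.lt_def]))

/-- Every predictable process is the evaluation of a tree. -/
theorem Predictable.exists_tree {Z : Type*} {n : ℕ} {D : (Fin n → Bool) → Fin n → Z}
    (hD : Predictable D) : ∃ z : Tree Z n, ∀ e t, z.val e t = D e t := by
  -- The prefix is padded with `false`; by predictability the padding does not affect the value.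
  refine ⟨fun t b => D (fun s => if h : (s : ℕ) < t then b ⟨s, h⟩ else false) t, fun e t => ?_⟩
  refine hD _ _ _ fun s hs => ?_
  have hs' : (s : ℕ) < t := hs
  simp [hs']

/-- An exponential supermartingale: peeling off the first sign, on which the first increment d does
not depend, leaves the factor cosh d · exp(-d²/2) ≤ 1. -/
theorem pathAvg_exp_le_one : ∀ {n : ℕ} {D : (Fin n → Bool) → Fin n → ℝ}, Predictable D →
    pathAvg n (fun e => Real.exp (∑ t, (sgn (e t) * D e t - D e t ^ 2 / 2))) ≤ 1
  | 0, D, _ => by simp [pathAvg_zero]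
  | n + 1, D, hD => by
    obtain ⟨d, hd⟩ : ∃ d, ∀ e, D e 0 = d :=
      ⟨D (fun _ => true) 0, fun e => hD _ _ _ fun s hs => absurd hs (Fin.not_lt_zero s)⟩
    have key : ∀ b : Bool, pathAvg n (fun e => Real.exp (∑ t, (sgn ((Fin.cons b e : Fin (n + 1) → Bool) t)
        * D (Fin.cons b e) t - D (Fin.cons b e) t ^ 2 / 2))) ≤ Real.exp (sgn b * d - d ^ 2 / 2) := by
      intro b
      have h := pathAvg_exp_le_one (hD.cons b)
      simp only [Fin.sum_univ_succ, Fin.cons_zero, Fin.cons_succ, hd, Real.exp_add]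
      rw [pathAvg_mul_left]
      exact mul_le_of_le_one_right (Real.exp_pos _).le h
    rw [pathAvg_succ]
    have h1 := key true
    have h2 := key false
    have h3 := Real.cosh_le_exp_half_sq d
    rw [Real.cosh_eq] at h3
    have h4 : Real.exp (sgn true * d - d ^ 2 / 2) + Real.exp (sgn false * d - d ^ 2 / 2) ≤ 2 := by
      simp only [sgn, if_true, Bool.false_eq_true, if_false, one_mul, neg_mul, Real.exp_sub]
      rw [← add_div, div_le_iff₀ (Real.exp_pos _)]
      linarith
    linarith

/-- The finite-class maximal inequality, for a choice of the class member along each path. -/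
theorem pathAvg_finite_class {n : ℕ} {ι : Type*} [Fintype ι]
    {D : ι → (Fin n → Bool) → Fin n → ℝ} (hD : ∀ i, Predictable (D i))
    (i : (Fin n → Bool) → ι) {μ : ℝ} (hμ : 0 < μ) :
    pathAvg n (fun e => ∑ t, sgn (e t) * D (i e) e t)
      ≤ μ / 2 * pathAvg n (fun e => ∑ t, D (i e) e t ^ 2) + Real.log (Fintype.card ι) / μ := by
  have hcard : 0 < (Fintype.card ι : ℝ) := by
    exact_mod_cast Fintype.card_pos_iff.2 ⟨i fun _ => true⟩
  -- The quadratic variation stays inside the exponent, so the final bound contains the variance of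
  -- the selected member only, not a maximum over the class. This is what an offset can absorb
  -- later.
  set M : ι → (Fin n → Bool) → ℝ := fun j e =>
    ∑ t, (sgn (e t) * (μ * D j e t) - (μ * D j e t) ^ 2 / 2) with hM
  have h1 : Real.exp (pathAvg n fun e => M (i e) e) ≤ Fintype.card ι := by
    refine (exp_pathAvg_le _ _).trans ?_
    calc pathAvg n (fun e => Real.exp (M (i e) e))
        ≤ pathAvg n (fun e => ∑ j, Real.exp (M j e)) :=
          pathAvg_mono fun e => Finset.single_le_sum (f := fun j => Real.exp (M j e))
            (fun j _ => (Real.exp_pos _).le) (Finset.mem_univ (i e))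
      _ = ∑ j, pathAvg n (fun e => Real.exp (M j e)) := pathAvg_sum _ _ _
      _ ≤ ∑ _j : ι, (1 : ℝ) :=
          Finset.sum_le_sum fun j _ => pathAvg_exp_le_one ((hD j).map fun d => μ * d)
      _ = Fintype.card ι := by simp
  rw [← Real.le_log_iff_exp_le hcard] at h1
  have h2 : (fun e => M (i e) e) = fun e => μ * (∑ t, sgn (e t) * D (i e) e t)
      - μ ^ 2 / 2 * ∑ t, D (i e) e t ^ 2 := by
    funext e
    simp only [hM, Finset.mul_sum, ← Finset.sum_sub_distrib]
    exact Finset.sum_congr rfl fun t _ => by ring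
  rw [h2, pathAvg_sub, pathAvg_mul_left, pathAvg_mul_left] at h1
  rw [← sub_le_iff_le_add', le_div_iff₀ hμ]
  linarith [h1]

/-! ### Minimax by separation and finite nets. -/

/-- A finite-dimensional minimax theorem: if every mixture of the coordinates is negative somewhere
on the convex set `A`, then some point of `A` has negative coordinates only. -/
theorem exists_mem_forall_neg {ι : Type*} [Fintype ι] {A : Set (ι → ℝ)} (hA : Convex ℝ A)
    (hne : A.Nonempty)
    (h : ∀ q : ι → ℝ, (∀ i, 0 ≤ q i) → ∑ i, q i = 1 → ∃ a ∈ A, ∑ i, q i * a i < 0) :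
    ∃ a ∈ A, ∀ i, a i < 0 := by
  classical
  by_contra! hcon
  have hO : IsOpen {y : ι → ℝ | ∀ i, y i < 0} := by
    simp only [Set.ofPred_forall]
    exact isOpen_iInter_of_finite fun i => isOpen_lt (continuous_apply i) continuous_const
  have hOc : Convex ℝ {y : ι → ℝ | ∀ i, y i < 0} := by
    simp only [Set.ofPred_forall]
    exact convex_iInter fun i => convex_halfSpace_lt (LinearMap.proj (R := ℝ) i).isLinear 0
  have hdisj : Disjoint {y : ι → ℝ | ∀ i, y i < 0} A := by
    rw [Set.disjoint_left]
    intro y hy hyA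
    obtain ⟨i, hi⟩ := hcon y hyA
    exact absurd (hy i) (not_lt.2 hi)
  -- If `A` misses the open negative orthant, a hyperplane separates them. Its normal `w` turns out
  -- nonnegative and nonzero, and its level `u` nonnegative, so normalizing `w` contradicts `h`.
  obtain ⟨f, u, hf, hu⟩ := geometric_hahn_banach_open hOc hO hA hdisj
  set w : ι → ℝ := fun i => f (Pi.single i 1) with hw
  have hfw : ∀ y, f y = ∑ i, w i * y i := by
    intro y
    conv_lhs => rw [← Finset.univ_sum_single y]
    rw [map_sum]
    refine Finset.sum_congr rfl fun i _ => ?_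
    have : (Pi.single i (y i) : ι → ℝ) = y i • Pi.single i 1 := by
      rw [← Pi.single_smul]; simp
    rw [this, map_smul, smul_eq_mul, mul_comm]
  have hw0 : ∀ i, 0 ≤ w i := by
    intro i
    by_contra! hi
    -- Lowering coordinate `i` stays in the orthant, where `f` is below `u`; a negative `w i` would
    -- make `f` unbounded above there.
    have key : ∀ s : ℝ, 0 ≤ s → -(∑ j, w j) - s * w i < u := by
      intro s hs
      have h1 := hf (fun j => -1 - if j = i then s else 0) (by
        intro j; dsimp only; split_ifs <;> linarith)
      rw [hfw] at h1
      simp only [mul_sub, mul_ite, mul_zero, Finset.sum_sub_distrib, Finset.sum_ite_eq',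
        Finset.mem_univ, if_true, mul_neg, mul_one, Finset.sum_neg_distrib] at h1
      linarith
    have h1 := key ((|u| + |∑ j, w j|) / (-w i)) (div_nonneg (by positivity) (by linarith))
    have h2 : (|u| + |∑ j, w j|) / (-w i) * w i = -(|u| + |∑ j, w j|) := by
      rw [div_neg, neg_mul, div_mul_cancel₀ _ hi.ne]
    rw [h2] at h1
    have := le_abs_self u
    have := le_abs_self (∑ j, w j)
    linarith
  have hu0 : 0 ≤ u := by
    by_contra! hneg
    have hs : 0 ≤ ∑ j, w j := Finset.sum_nonneg fun j _ => hw0 j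
    have h1 := hf (fun _ => u / (∑ j, w j + 1)) fun _ => div_neg_of_neg_of_pos hneg (by linarith)
    rw [hfw, ← Finset.sum_mul, ← mul_div_assoc, div_lt_iff₀ (by linarith)] at h1
    nlinarith
  obtain ⟨a₀, ha₀⟩ := hne
  have hspos : 0 < ∑ j, w j := by
    refine lt_of_le_of_ne (Finset.sum_nonneg fun j _ => hw0 j) fun h0 => ?_
    have hz : ∀ j, w j = 0 := fun j =>
      (Finset.sum_eq_zero_iff_of_nonneg fun j _ => hw0 j).1 h0.symm j (Finset.mem_univ j)
    have h1 := hf (fun _ => -1) (fun _ => by norm_num)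
    have h2 := hu a₀ ha₀
    simp only [hfw, hz, zero_mul, Finset.sum_const_zero] at h1 h2
    linarith
  obtain ⟨a, ha, hlt⟩ := h (fun i => w i / ∑ j, w j) (fun i => div_nonneg (hw0 i) hspos.le)
    (by rw [← Finset.sum_div, div_self hspos.ne'])
  have h1 := hu a ha
  rw [hfw] at h1
  have h2 : ∑ i, w i / (∑ j, w j) * a i = (∑ i, w i * a i) / ∑ j, w j := by
    rw [Finset.sum_div]
    exact Finset.sum_congr rfl fun i _ => by ring
  rw [h2, div_neg_iff] at hlt
  rcases hlt with h | h <;> linarith [h.1, h.2]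

/-- The vectors of expected payoffs under the probability measures form a convex set. -/
theorem convex_range_integral {S ι : Type*} [MeasurableSpace S] (f : ι → S → ℝ)
    (hm : ∀ i, Measurable (f i)) {C : ℝ} (hb : ∀ i s, |f i s| ≤ C) :
    Convex ℝ (Set.range fun (p : ProbabilityMeasure S) i => ∫ s, f i s ∂(p : Measure S)) := by
  rintro _ ⟨p, rfl⟩ _ ⟨q, rfl⟩ a b ha hb' hab
  have hint : ∀ (p : ProbabilityMeasure S) i, Integrable (f i) (p : Measure S) := fun p i =>
    Integrable.of_bound (hm i).aestronglyMeasurable C (Filter.Eventually.of_forall (hb i))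
  refine ⟨⟨ENNReal.ofReal a • (p : Measure S) + ENNReal.ofReal b • (q : Measure S), ⟨?_⟩⟩, ?_⟩
  · simp [← ENNReal.ofReal_add ha hb', hab]
  · funext i
    have h1 := integral_add_measure ((hint p i).smul_measure (c := ENNReal.ofReal a) (by simp))
      ((hint q i).smul_measure (c := ENNReal.ofReal b) (by simp))
    simp only [ProbabilityMeasure.coe_mk, Pi.add_apply, Pi.smul_apply]
    rw [h1, integral_smul_measure, integral_smul_measure, ENNReal.toReal_ofReal ha,
      ENNReal.toReal_ofReal hb']

/-- The minimax theorem up to `δ`, for payoffs with a finite net in the second variable. -/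
theorem exists_probabilityMeasure_forall_le {S O : Type*} [MeasurableSpace S] [Nonempty S]
    (f : S → O → ℝ) (hm : ∀ o, Measurable fun s => f s o) {C : ℝ} (hb : ∀ s o, |f s o| ≤ C)
    {δ v : ℝ} {N : Set O} (hN : N.Finite) (hnet : ∀ o, ∃ o' ∈ N, ∀ s, f s o ≤ f s o' + δ)
    (hdual : ∀ (ι : Type) [Fintype ι] (q : ι → ℝ) (o : ι → O), (∀ i, 0 ≤ q i) → ∑ i, q i = 1 →
      ∃ s, ∑ i, q i * f s (o i) < v) :
    ∃ p : ProbabilityMeasure S, ∀ o, ∫ s, f s o ∂(p : Measure S) ≤ v + δ := by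
  have hint : ∀ (p : ProbabilityMeasure S) o, Integrable (fun s => f s o) (p : Measure S) :=
    fun p o => Integrable.of_bound (hm o).aestronglyMeasurable C
      (Filter.Eventually.of_forall fun s => hb s o)
  obtain ⟨n, o, rfl⟩ : ∃ (n : ℕ) (o : Fin n → O), Set.range o = N := by
    have := hN.fintype
    refine ⟨Fintype.card N, fun i => (Fintype.equivFin N).symm i, ?_⟩
    rw [Set.range_comp' Subtype.val, (Fintype.equivFin N).symm.surjective.range_eq]
    simp
  have hconv := convex_range_integral (fun (i : Fin n) s => f s (o i) - v)
    (fun i => (hm _).sub_const v) (C := C + |v|)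
    (fun i s => (abs_sub _ _).trans (add_le_add (hb _ _) le_rfl))
  have heq : ∀ (p : ProbabilityMeasure S) i, ∫ s, (f s (o i) - v) ∂(p : Measure S)
      = ∫ s, f s (o i) ∂(p : Measure S) - v := by
    intro p i
    rw [integral_sub (hint p _) (integrable_const _)]
    simp
  let dirac : S → ProbabilityMeasure S := fun s => ⟨Measure.dirac s, inferInstance⟩
  -- Pure actions, as Dirac measures, answer every mixture on the net; mixed actions enter through
  -- the convexity of the payoff set.
  obtain ⟨_, ⟨p, rfl⟩, hp⟩ := exists_mem_forall_neg hconv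
    ⟨_, dirac (Classical.arbitrary S), rfl⟩ (by
      intro q hq hq1
      obtain ⟨s, hs⟩ := hdual (Fin n) q o hq hq1
      refine ⟨_, ⟨dirac s, rfl⟩, ?_⟩
      have : ∀ i, ∫ s', (f s' (o i) - v) ∂(dirac s : Measure S) = f s (o i) - v := fun i =>
        integral_dirac' _ _ ((hm _).sub_const v).stronglyMeasurable
      simp only [this, mul_sub, Finset.sum_sub_distrib, ← Finset.sum_mul, hq1]
      linarith)
  refine ⟨p, fun o' => ?_⟩
  obtain ⟨_, ⟨i, rfl⟩, hi⟩ := hnet o'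
  have h1 : ∫ s, f s o' ∂(p : Measure S) ≤ ∫ s, (f s (o i) + δ) ∂(p : Measure S) :=
    integral_mono (hint p _) ((hint p _).add (integrable_const _)) hi
  rw [integral_add (hint p _) (integrable_const _)] at h1
  have h2 := hp i
  simp only [heq] at h2
  simp at h1
  linarith

/-- A map with bounded range in a proper space admits finite nets in its domain. -/
theorem exists_finite_net {O E : Type*} [PseudoMetricSpace E] [ProperSpace E] (θ : O → E)
    (hθ : Bornology.IsBounded (Set.range θ)) {δ : ℝ} (hδ : 0 < δ) :
    ∃ N : Set O, N.Finite ∧ ∀ o, ∃ o' ∈ N, dist (θ o) (θ o') < δ := by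
  obtain ⟨t, hts, htf, ht⟩ := (hθ.isCompact_closure.totallyBounded.subset subset_closure).exists_subset (Metric.dist_mem_uniformity hδ)
  rcases isEmpty_or_nonempty O with hO | hO
  · exact ⟨∅, Set.finite_empty, fun o => hO.elim o⟩
  have hts' : ∀ y ∈ t, ∃ o, θ o = y := fun y hy => hts hy
  choose! r hr using hts'
  refine ⟨r '' t, htf.image r, fun o => ?_⟩
  obtain ⟨y, hy, hlt⟩ := Set.mem_iUnion₂.1 (ht ⟨o, rfl⟩)
  exact ⟨r y, ⟨y, hy, rfl⟩, by rw [hr y hy]; exact hlt⟩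

/-! ### The symmetrized game and its value. -/

section Game

variable {γ X O : Type*}

/-- The loss deflated by half of the offset. -/
noncomputable def deflate (c z : ℝ) : ℝ := z - c / 2 * z ^ 2

/-- The increment of the symmetrized game for a pair of outcomes. -/
noncomputable def increment (Z : X → O → γ → ℝ) (c : ℝ) (x : X) (o o' : O) (g : γ) : ℝ :=
  deflate c (Z x o' g) - deflate c (Z x o g) - c / 2 * (Z x o' g ^ 2 + Z x o g ^ 2)

/-- The affine functionals of the state whose supremum is the value of the symmetrized game with
`n` remaining rounds. -/
noncomputable def functionals (Z : X → O → γ → ℝ) (c : ℝ) (ρ : O → ℝ) : ℕ → Set ((γ → ℝ) → ℝ)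
  | 0 => Set.range fun g F => F g
  | n + 1 => {Λ | ∃ x o o', ∃ Λ₁ ∈ functionals Z c ρ n, ∃ Λ₂ ∈ functionals Z c ρ n,
      Λ = fun F => (Λ₁ (F + increment Z c x o o') + Λ₂ (F + increment Z c x o' o)
        - ρ o - ρ o') / 2}

/-- The value of the symmetrized game with `n` remaining rounds in the state `F`. -/
noncomputable def gameValue (Z : X → O → γ → ℝ) (c : ℝ) (ρ : O → ℝ) (n : ℕ) (F : γ → ℝ) : ℝ :=
  sSup ((fun Λ => Λ F) '' functionals Z c ρ n)

variable {Z : X → O → γ → ℝ} {c : ℝ} {ρ : O → ℝ}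

/-- Monotonicity, equivariance under constants and affinity are all that `exists_response` uses of
the functionals when it moves inequalities and mixtures inside them. -/
theorem functionals_mono : ∀ {n : ℕ} {Λ : (γ → ℝ) → ℝ}, Λ ∈ functionals Z c ρ n →
    Monotone Λ
  | 0, _, ⟨g, hg⟩, F, F', h => by subst hg; exact h g
  | n + 1, _, ⟨x, o, o', Λ₁, h₁, Λ₂, h₂, hΛ⟩, F, F', h => by
    subst hΛ
    have := functionals_mono h₁ (add_le_add_left h (increment Z c x o o'))
    have := functionals_mono h₂ (add_le_add_left h (increment Z c x o' o))
    dsimp only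
    linarith

theorem functionals_add_const : ∀ {n : ℕ} {Λ : (γ → ℝ) → ℝ}, Λ ∈ functionals Z c ρ n →
    ∀ (F : γ → ℝ) (a : ℝ), Λ (fun g => F g + a) = Λ F + a
  | 0, _, ⟨g, hg⟩, F, a => by subst hg; rfl
  | n + 1, _, ⟨x, o, o', Λ₁, h₁, Λ₂, h₂, hΛ⟩, F, a => by
    subst hΛ
    have e : ∀ D : γ → ℝ, (fun g => F g + a) + D = fun g => (F + D) g + a := fun D => by
      funext g; simp only [Pi.add_apply]; ring
    simp only [e, functionals_add_const h₁, functionals_add_const h₂]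
    ring

theorem functionals_sum {ι : Type*} [Fintype ι] {q : ι → ℝ} (hq : ∑ i, q i = 1) :
    ∀ {n : ℕ} {Λ : (γ → ℝ) → ℝ}, Λ ∈ functionals Z c ρ n →
    ∀ (F : ι → γ → ℝ), Λ (fun g => ∑ i, q i * F i g) = ∑ i, q i * Λ (F i)
  | 0, _, ⟨g, hg⟩, F => by subst hg; rfl
  | n + 1, _, ⟨x, o, o', Λ₁, h₁, Λ₂, h₂, hΛ⟩, F => by
    subst hΛ
    have e : ∀ D : γ → ℝ, (fun g => ∑ i, q i * F i g) + D
        = fun g => ∑ i, q i * (F i + D) g := fun D => by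
      funext g
      simp only [Pi.add_apply, mul_add, Finset.sum_add_distrib, ← Finset.sum_mul, hq, one_mul]
    simp only [e, functionals_sum hq h₁, functionals_sum hq h₂]
    have h3 : ∀ r : ℝ, r = ∑ i, q i * r := fun r => by rw [← Finset.sum_mul, hq, one_mul]
    conv_lhs => rw [h3 (ρ o), h3 (ρ o')]
    rw [← Finset.sum_add_distrib, ← Finset.sum_sub_distrib, ← Finset.sum_sub_distrib,
      Finset.sum_div]
    exact Finset.sum_congr rfl fun i _ => by ring

theorem functionals_bounded {C P : ℝ} (hD : ∀ x o o' g, |increment Z c x o o' g| ≤ C)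
    (hρ : ∀ o, |ρ o| ≤ P) : ∀ (n : ℕ) (M : ℝ), ∃ M', ∀ Λ ∈ functionals Z c ρ n,
    ∀ F : γ → ℝ, (∀ g, |F g| ≤ M) → |Λ F| ≤ M'
  | 0, M => ⟨M, by rintro _ ⟨g, rfl⟩ F hF; exact hF g⟩
  | n + 1, M => by
    obtain ⟨M', hM'⟩ := functionals_bounded hD hρ n (M + C)
    refine ⟨M' + P, ?_⟩
    rintro _ ⟨x, o, o', Λ₁, h₁, Λ₂, h₂, rfl⟩ F hF
    have hb : ∀ o o' g, |(F + increment Z c x o o') g| ≤ M + C := fun o o' g =>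
      (abs_add_le _ _).trans (add_le_add (hF g) (hD _ _ _ _))
    have e1 := abs_le.1 (hM' Λ₁ h₁ _ (hb o o'))
    have e2 := abs_le.1 (hM' Λ₂ h₂ _ (hb o' o))
    have e3 := abs_le.1 (hρ o)
    have e4 := abs_le.1 (hρ o')
    rw [abs_le]
    constructor <;> linarith [e1.1, e1.2, e2.1, e2.2, e3.1, e3.2, e4.1, e4.2]

theorem functionals_nonempty [Nonempty γ] [Nonempty X] [Nonempty O] :
    ∀ n, (functionals Z c ρ n).Nonempty
  | 0 => Set.range_nonempty _
  | n + 1 => by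
    obtain ⟨Λ, h⟩ := functionals_nonempty n
    exact ⟨_, Classical.arbitrary X, Classical.arbitrary O, Classical.arbitrary O, Λ, h, Λ, h, rfl⟩

section Bounded

variable {C P : ℝ} (hD : ∀ x o o' g, |increment Z c x o o' g| ≤ C) (hρ : ∀ o, |ρ o| ≤ P)
include hD hρ

theorem gameValue_bddAbove {F : γ → ℝ} {M : ℝ} (hF : ∀ g, |F g| ≤ M) (n : ℕ) :
    BddAbove ((fun Λ => Λ F) '' functionals Z c ρ n) := by
  obtain ⟨M', h⟩ := functionals_bounded hD hρ n M
  refine ⟨M', ?_⟩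
  rintro _ ⟨Λ, hΛ, rfl⟩
  exact (abs_le.1 (h Λ hΛ F hF)).2

theorem le_gameValue {F : γ → ℝ} {M : ℝ} (hF : ∀ g, |F g| ≤ M) {n : ℕ} {Λ : (γ → ℝ) → ℝ}
    (hΛ : Λ ∈ functionals Z c ρ n) : Λ F ≤ gameValue Z c ρ n F :=
  le_csSup (gameValue_bddAbove hD hρ hF n) ⟨Λ, hΛ, rfl⟩

theorem gameValue_bounded (n : ℕ) (M : ℝ) : ∃ M', ∀ F : γ → ℝ, (∀ g, |F g| ≤ M) →
    |gameValue Z c ρ n F| ≤ M' := by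
  obtain ⟨M', h⟩ := functionals_bounded hD hρ n M
  refine ⟨|M'|, fun F hF => ?_⟩
  rcases (functionals Z c ρ n).eq_empty_or_nonempty with h0 | ⟨Λ, hΛ⟩
  · simp [gameValue, h0]
  · have h1 := abs_le.1 (h Λ hΛ F hF)
    have h2 := le_gameValue hD hρ hF hΛ
    have h3 : gameValue Z c ρ n F ≤ M' := csSup_le ⟨_, Λ, hΛ, rfl⟩ (by
      rintro _ ⟨Λ, hΛ, rfl⟩
      exact (abs_le.1 (h Λ hΛ F hF)).2)
    rw [abs_le]
    constructor <;> linarith [le_abs_self M', h1.1]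

/-- Against every mixture of the outcomes the learner can achieve the value of the symmetrized
game, up to `δ`. -/
theorem exists_response [Nonempty γ] {A : Type*} {f : A → O → ℝ} {x : X}
    (hf : ∀ g, ∃ a, ∀ o, f a o = Z x o g - c * Z x o g ^ 2)
    {ι : Type*} [Fintype ι] {q : ι → ℝ} (hq0 : ∀ i, 0 ≤ q i) (hq : ∑ i, q i = 1) (o : ι → O)
    {F : γ → ℝ} {M : ℝ} (hF : ∀ g, |F g| ≤ M) (n : ℕ) {δ : ℝ} (hδ : 0 < δ) :
    ∃ a, ∑ i, q i * (f a (o i) - ρ (o i) + gameValue Z c ρ n (F - Z x (o i)))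
      < gameValue Z c ρ (n + 1) F + δ := by
  by_contra! hcon
  have : Nonempty X := ⟨x⟩
  have : Nonempty ι := by
    by_contra hι
    rw [not_nonempty_iff] at hι
    simp at hq
  have : Nonempty O := ⟨o (Classical.arbitrary ι)⟩
  set V := gameValue Z c ρ (n + 1) F with hV
  -- The near-optimal functional depends on the outcome `o i` alone, so it can be paired with every
  -- second outcome `o j`.
  have hΛ : ∀ i, ∃ Λ ∈ functionals Z c ρ n,
      gameValue Z c ρ n (F - Z x (o i)) - δ / 2 ≤ Λ (F - Z x (o i)) := by
    intro i
    obtain ⟨_, ⟨Λ, hΛ, rfl⟩, hlt⟩ := exists_lt_of_lt_csSup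
      ((functionals_nonempty (Z := Z) (c := c) (ρ := ρ) n).image fun Λ => Λ (F - Z x (o i)))
      (show gameValue Z c ρ n (F - Z x (o i)) - δ / 2 < sSup _ from sub_lt_self _ (by linarith))
    exact ⟨Λ, hΛ, hlt.le⟩
  choose Λ hΛm hΛle using hΛ
  set W := ∑ i, q i * (gameValue Z c ρ n (F - Z x (o i)) - ρ (o i)) with hW
  set m := V + δ - W with hm
  -- Failure against all responses includes failure against the response that imitates `g`.
  have hmle : ∀ g, m ≤ ∑ j, q j * (Z x (o j) g - c * Z x (o j) g ^ 2) := by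
    intro g
    obtain ⟨a, ha⟩ := hf g
    have h1 := hcon a
    have h2 : ∑ i, q i * (f a (o i) - ρ (o i) + gameValue Z c ρ n (F - Z x (o i)))
        = ∑ j, q j * (Z x (o j) g - c * Z x (o j) g ^ 2) + W := by
      rw [hW, ← Finset.sum_add_distrib]
      exact Finset.sum_congr rfl fun i _ => by rw [ha]; ring
    linarith
  have h1 : ∀ i, Λ i (F - Z x (o i)) + m
      ≤ ∑ j, q j * Λ i (F + increment Z c x (o i) (o j)) := by
    intro i
    rw [← functionals_add_const (hΛm i), ← functionals_sum hq (hΛm i)]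
    refine functionals_mono (hΛm i) fun g => ?_
    -- The squares of `Z x (o i) g` cancel in the increment, which is Z' - cZ'² - Z.
    have h2 : ∑ j, q j * (F + increment Z c x (o i) (o j)) g
        = (F g - Z x (o i) g) + ∑ j, q j * (Z x (o j) g - c * Z x (o j) g ^ 2) := by
      have h3 : F g - Z x (o i) g = ∑ j, q j * (F g - Z x (o i) g) := by
        rw [← Finset.sum_mul, hq, one_mul]
      rw [h3, ← Finset.sum_add_distrib]
      refine Finset.sum_congr rfl fun j _ => ?_
      simp only [Pi.add_apply, increment, deflate]
      ring
    rw [h2]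
    exact add_le_add le_rfl (hmle g)
  have h2 : ∀ i j, Λ i (F + increment Z c x (o i) (o j)) + Λ j (F + increment Z c x (o j) (o i))
      - ρ (o i) - ρ (o j) ≤ 2 * V := by
    intro i j
    have := le_gameValue hD hρ hF (n := n + 1)
      ⟨x, o i, o j, Λ i, hΛm i, Λ j, hΛm j, rfl⟩
    rw [← hV] at this
    linarith
  -- Symmetrization: the double sum is added to itself with `i` and `j` exchanged, and each pair is
  -- then a legal move of the game with `n + 1` rounds.
  have h3 : ∑ i, ∑ j, q i * (q j * (Λ i (F + increment Z c x (o i) (o j)) - ρ (o i))) ≤ V := by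
    have h4 : ∑ i, ∑ j, q i * (q j * (Λ i (F + increment Z c x (o i) (o j)) - ρ (o i)))
        + ∑ i, ∑ j, q i * (q j * (Λ i (F + increment Z c x (o i) (o j)) - ρ (o i)))
        ≤ ∑ i, ∑ j, q i * (q j * (2 * V)) := by
      conv_lhs => rw [add_comm]; arg 1; rw [Finset.sum_comm]
      rw [← Finset.sum_add_distrib]
      refine Finset.sum_le_sum fun i _ => ?_
      rw [← Finset.sum_add_distrib]
      refine Finset.sum_le_sum fun j _ => ?_
      have := mul_le_mul_of_nonneg_left (h2 i j) (mul_nonneg (hq0 i) (hq0 j))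
      linarith
    have h5 : ∑ i, ∑ j, q i * (q j * (2 * V)) = 2 * V := by
      simp only [← Finset.mul_sum, ← Finset.sum_mul, hq, one_mul]
    linarith
  have h6 : ∀ i, q i * ((gameValue Z c ρ n (F - Z x (o i)) - ρ (o i)) + (m - δ / 2))
      ≤ ∑ j, q i * (q j * (Λ i (F + increment Z c x (o i) (o j)) - ρ (o i))) := by
    intro i
    rw [← Finset.mul_sum]
    refine mul_le_mul_of_nonneg_left ?_ (hq0 i)
    simp only [mul_sub, Finset.sum_sub_distrib, ← Finset.sum_mul, hq, one_mul]
    have := h1 i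
    have := hΛle i
    linarith
  have h7 := (Finset.sum_le_sum fun i (_ : i ∈ Finset.univ) => h6 i).trans h3
  simp only [mul_add, Finset.sum_add_distrib, ← Finset.sum_mul, hq, one_mul] at h7
  linarith

end Bounded

theorem Predictable.cons_ite {W : Type*} {n : ℕ} {w₁ w₂ : (Fin n → Bool) → Fin n → W}
    (h₁ : Predictable w₁) (h₂ : Predictable w₂) (w : W) :
    Predictable fun (e : Fin (n + 1) → Bool) =>
      (Fin.cons w (if e 0 then w₁ (Fin.tail e) else w₂ (Fin.tail e)) : Fin (n + 1) → W) := by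
  intro e e' t h
  induction t using Fin.cases with
  | zero => simp
  | succ t =>
    have h0 : e 0 = e' 0 := h 0 (Fin.succ_pos t)
    simp only [Fin.cons_succ, h0]
    split_ifs
    · exact h₁ _ _ _ fun s hs => h s.succ (Fin.succ_lt_succ_iff.2 hs)
    · exact h₂ _ _ _ fun s hs => h s.succ (Fin.succ_lt_succ_iff.2 hs)

/-- The functionals of the symmetrized game are averages along the paths of predictable
processes. -/
theorem functionals_eq_pathAvg : ∀ {n : ℕ} {Λ : (γ → ℝ) → ℝ}, Λ ∈ functionals Z c ρ n →
    ∃ (x : (Fin n → Bool) → Fin n → X) (o o' : (Fin n → Bool) → Fin n → O)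
      (g : (Fin n → Bool) → γ), Predictable x ∧ Predictable o ∧ Predictable o' ∧
      ∀ F, Λ F = pathAvg n fun e => F (g e) + ∑ t,
        (sgn (e t) * (deflate c (Z (x e t) (o' e t) (g e)) - deflate c (Z (x e t) (o e t) (g e)))
          - c / 2 * (Z (x e t) (o' e t) (g e) ^ 2 + Z (x e t) (o e t) (g e) ^ 2)
          - (ρ (o e t) + ρ (o' e t)) / 2)
  | 0, _, ⟨g, hg⟩ => by
    subst hg
    exact ⟨fun _ => Fin.elim0, fun _ => Fin.elim0, fun _ => Fin.elim0, fun _ => g,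
      fun _ _ t => t.elim0, fun _ _ t => t.elim0, fun _ _ t => t.elim0, by simp [pathAvg_zero]⟩
  | n + 1, _, ⟨x, o, o', Λ₁, h₁, Λ₂, h₂, hΛ⟩ => by
    subst hΛ
    obtain ⟨x₁, o₁, o₁', g₁, hx₁, ho₁, ho₁', hF₁⟩ := functionals_eq_pathAvg h₁
    obtain ⟨x₂, o₂, o₂', g₂, hx₂, ho₂, ho₂', hF₂⟩ := functionals_eq_pathAvg h₂
    refine ⟨_, _, _, fun e => if e 0 then g₁ (Fin.tail e) else g₂ (Fin.tail e),
      hx₁.cons_ite hx₂ x, ho₁.cons_ite ho₂ o, ho₁'.cons_ite ho₂' o', fun F => ?_⟩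
    rw [pathAvg_succ]
    change (Λ₁ _ + Λ₂ _ - ρ o - ρ o') / 2 = _
    rw [hF₁, hF₂]
    simp only [Fin.sum_univ_succ, Fin.cons_zero, Fin.cons_succ, Fin.tail_cons, if_true,
      Bool.false_eq_true, if_false]
    have e₁ : ∀ (G : (Fin n → Bool) → ℝ) (a : ℝ),
        pathAvg n G - a = pathAvg n (fun e => G e - a) := fun G a => by
      rw [pathAvg_sub, pathAvg_const]
    rw [show ∀ a b r s : ℝ, (a + b - r - s) / 2 = ((a - (r + s) / 2) + (b - (r + s) / 2)) / 2 from
      fun a b r s => by ring, e₁, e₁]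
    congr 2
    · congr 1
      funext e
      simp only [Pi.add_apply, increment, sgn, if_true]
      ring
    · congr 1
      funext e
      simp only [Pi.add_apply, increment, sgn, Bool.false_eq_true, if_false]
      ring

end Game

/-! ### Finite covers from finite entropy. -/

section Entropy

variable {X : Type*} {K : ℕ} {G : Set (X → Fin K → ℝ)}

theorem seqCoverNum_antitone (G : Set (X → Fin K → ℝ)) (T : ℕ) :
    Antitone fun ε => seqCoverNum ε G T := by
  intro ε ε' h
  refine iSup_mono fun x => le_iInf₂ fun V hV => iInf₂_le V fun g hg e => ?_
  obtain ⟨v, hv, hle⟩ := hV g hg e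
  exact ⟨v, hv, fun t => (hle t).trans h⟩

theorem seqEntropy_antitone (G : Set (X → Fin K → ℝ)) (T : ℕ) :
    Antitone fun ε => seqEntropy ε G T := fun _ _ h =>
  EReal.toENNReal_le_toENNReal (ENNReal.log_monotone
    (ENat.toENNReal_le.2 (seqCoverNum_antitone G T h)))

/-- If the entropy is finite, every tree has a finite cover whose logarithmic size is at most the
entropy. -/
theorem exists_finite_cover {T : ℕ} {ε : ℝ} (h : seqEntropy ε G T ≠ ⊤) (x : Tree X T) :
    ∃ (m : ℕ) (u : Fin m → Tree (Fin K → ℝ) T), IsSeqCover ε G x (Set.range u) ∧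
      Real.log m ≤ (seqEntropy ε G T).toReal := by
  have htop : seqCoverNum ε G T ≠ ⊤ := by
    intro h0
    simp [seqEntropy, h0] at h
  obtain ⟨n, hn⟩ := ENat.ne_top_iff_exists.1 htop
  -- A strict bound on the infimum yields an actual cover, of size at most `n`.
  have hlt : seqCoverNumOn ε G x < (n + 1 : ℕ) := by
    refine lt_of_le_of_lt (le_iSup (fun x : Tree X T => seqCoverNumOn ε G x) x) ?_
    change seqCoverNum ε G T < _
    rw [← hn]
    exact_mod_cast Nat.lt_succ_self n
  simp only [seqCoverNumOn, iInf_lt_iff] at hlt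
  obtain ⟨V, hV, hlt⟩ := hlt
  have hfin : V.Finite := Set.encard_lt_top_iff.1 (hlt.trans (ENat.natCast_lt_top _))
  have := hfin.fintype
  refine ⟨Fintype.card V, fun i => (Fintype.equivFin V).symm i, ?_, ?_⟩
  · rw [Set.range_comp' Subtype.val, (Fintype.equivFin V).symm.surjective.range_eq]
    simpa using hV
  · have hcard : Fintype.card V ≤ n := by
      rw [Set.encard_eq_coe_toFinset_card, Set.toFinset_card] at hlt
      exact Nat.lt_succ_iff.1 (by exact_mod_cast hlt)
    -- The cover is empty only if `G` is; the bound then relies on `Real.log 0 = 0`.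
    rcases Nat.eq_zero_or_pos (Fintype.card V) with h0 | hpos
    · rw [h0]; simp
    · have hn1 : 1 ≤ n := hpos.trans_le hcard
      have : seqEntropy ε G T = ENNReal.ofReal (Real.log n) := by
        rw [seqEntropy, ← hn, ENat.toENNReal_coe, ← ENNReal.ofReal_natCast,
          ENNReal.log_ofReal_of_pos (by exact_mod_cast hn1), EReal.toENNReal_of_ne_top (by simp)]
        simp
      rw [this, ENNReal.toReal_ofReal (Real.log_natCast_nonneg n)]
      exact Real.log_le_log (by exact_mod_cast hpos) (by exact_mod_cast hcard)

end Entropy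

/-! ### Chaining of path-dependent selections. -/

section Chaining

variable {n : ℕ}

/-- The process `w` selects along each path a member of a predictable family of logarithmic size at
most `h`, and approximates `Y` up to `ε * N`. -/
def IsApprox (Y N : (Fin n → Bool) → Fin n → ℝ) (ε h : ℝ)
    (w : (Fin n → Bool) → Fin n → ℝ) : Prop :=
  ∃ (m : ℕ) (v : Fin m → (Fin n → Bool) → Fin n → ℝ) (i : (Fin n → Bool) → Fin m),
    (∀ k, Predictable (v k)) ∧ (∀ e t, v (i e) e t = w e t) ∧ Real.log m ≤ h ∧
      ∀ e t, |w e t - Y e t| ≤ ε * N e t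

variable {Y N : (Fin n → Bool) → Fin n → ℝ}

theorem IsApprox.root {ε h : ℝ} {w : (Fin n → Bool) → Fin n → ℝ} (hw : IsApprox Y N ε h w)
    {Z : (Fin n → Bool) → Fin n → ℝ} (hZ : ∀ e t, |w e t| ≤ Z e t) {μ : ℝ} (hμ : 0 < μ) :
    pathAvg n (fun e => ∑ t, sgn (e t) * w e t)
      ≤ μ / 2 * pathAvg n (fun e => ∑ t, Z e t ^ 2) + h / μ := by
  obtain ⟨m, v, i, hv, hvw, hm, -⟩ := hw
  have h1 := pathAvg_finite_class hv i hμ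
  simp only [hvw, Fintype.card_fin] at h1
  refine h1.trans (add_le_add (mul_le_mul_of_nonneg_left (pathAvg_mono fun e =>
    Finset.sum_le_sum fun t _ => ?_) (by positivity)) (by gcongr))
  exact sq_le_sq.2 ((hZ e t).trans (le_abs_self _))

/-- The increment `w' - w` is selected from the family of pairs, so the entropies add, and by the
triangle inequality through `Y` it is at most (ε + ε')N. -/
theorem IsApprox.link {ε ε' h h' : ℝ} {w w' : (Fin n → Bool) → Fin n → ℝ}
    (hw : IsApprox Y N ε h w) (hw' : IsApprox Y N ε' h' w') {μ : ℝ} (hμ : 0 < μ) :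
    pathAvg n (fun e => ∑ t, sgn (e t) * w' e t)
      ≤ pathAvg n (fun e => ∑ t, sgn (e t) * w e t)
        + (μ / 2 * ((ε + ε') ^ 2 * pathAvg n (fun e => ∑ t, N e t ^ 2)) + (h + h') / μ) := by
  obtain ⟨m, v, i, hv, hvw, hm, hY⟩ := hw
  obtain ⟨m', v', i', hv', hvw', hm', hY'⟩ := hw'
  have h1 := pathAvg_finite_class (D := fun (k : Fin m × Fin m') e t => v' k.2 e t - v k.1 e t)
    (fun k => (hv' k.2).map₂ (hv k.1) fun a b => a - b) (fun e => (i e, i' e)) hμ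
  simp only [hvw, hvw', Fintype.card_prod, Fintype.card_fin, Nat.cast_mul, mul_sub,
    Finset.sum_sub_distrib, pathAvg_sub] at h1
  have hm0 : (m : ℝ) ≠ 0 := by
    have := (i fun _ => true).pos
    positivity
  have hm0' : (m' : ℝ) ≠ 0 := by
    have := (i' fun _ => true).pos
    positivity
  rw [Real.log_mul hm0 hm0'] at h1
  have h2 : pathAvg n (fun e => ∑ t, (w' e t - w e t) ^ 2)
      ≤ (ε + ε') ^ 2 * pathAvg n (fun e => ∑ t, N e t ^ 2) := by
    rw [← pathAvg_mul_left]
    refine pathAvg_mono fun e => ?_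
    rw [Finset.mul_sum]
    refine Finset.sum_le_sum fun t _ => ?_
    rw [← mul_pow]
    refine sq_le_sq.2 (le_trans ?_ (le_abs_self _))
    have h5 := abs_sub_le (w' e t) (Y e t) (w e t)
    rw [abs_sub_comm (Y e t) (w e t)] at h5
    linarith [hY e t, hY' e t]
  have h3 := mul_le_mul_of_nonneg_left h2 (half_pos hμ).le
  have h4 : (Real.log m + Real.log m') / μ ≤ (h + h') / μ := by gcongr
  linarith

/-- Optimizing the free parameter of a subgaussian bound. -/
theorem le_of_forall_tradeoff {A a Q h κ : ℝ} (ha : 0 < a) (hh : 0 ≤ h) (hκ : 0 < κ)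
    (H : ∀ μ : ℝ, 0 < μ → A ≤ μ / 2 * (a ^ 2 * Q) + 2 * h / μ) :
    A ≤ a * √h * (κ / 2 * Q + 2 / κ) := by
  rcases hh.eq_or_lt with rfl | hpos
  · simp only [Real.sqrt_zero, mul_zero, zero_mul, zero_div, add_zero] at H ⊢
    by_contra! hA
    -- Without entropy the bound vanishes as μ → 0; this μ already forces A ≤ A/2.
    have h1 := H (A / (a ^ 2 * |Q| + 1)) (by positivity)
    have h2 : A / (a ^ 2 * |Q| + 1) * (a ^ 2 * |Q| + 1) = A := div_mul_cancel₀ _ (by positivity)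
    have h3 : A / (a ^ 2 * |Q| + 1) * (a ^ 2 * Q) ≤ A := by
      conv_rhs => rw [← h2]
      refine mul_le_mul_of_nonneg_left ?_ (by positivity)
      nlinarith [le_abs_self Q, sq_nonneg a]
    linarith
  · have hs : 0 < √h := Real.sqrt_pos.2 hpos
    -- This μ makes both terms multiples of a√h. Since `κ` does not depend on the scale, the other
    -- factor is common to all links.
    have h1 := H (√h * κ / a) (by positivity)
    have h2 : √h ^ 2 = h := Real.sq_sqrt hh
    refine h1.trans (le_of_eq ?_)
    generalize √h = r at *
    subst h2
    field_simp

/-- Successive accuracies add up to 3 · β/2^(j+1), and the entropies of a link to at most 2h(j+1).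
-/
theorem chaining {β κ : ℝ} (hβ : 0 < β) (hκ : 0 < κ) {h : ℕ → ℝ} (hh : ∀ j, 0 ≤ h j) {J : ℕ}
    (hmono : ∀ j < J, h j ≤ h (j + 1)) {w : ℕ → (Fin n → Bool) → Fin n → ℝ}
    (hw : ∀ j ≤ J, IsApprox Y N (β / 2 ^ j) (h j) (w j)) :
    pathAvg n (fun e => ∑ t, sgn (e t) * w J e t)
      ≤ pathAvg n (fun e => ∑ t, sgn (e t) * w 0 e t)
        + 3 * (∑ j ∈ Finset.range J, β / 2 ^ (j + 1) * √(h (j + 1)))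
          * (κ / 2 * pathAvg n (fun e => ∑ t, N e t ^ 2) + 2 / κ) := by
  induction J with
  | zero => simp
  | succ J ih =>
    have h1 := ih (fun j hj => hmono j (hj.trans (Nat.lt_succ_self J)))
      fun j hj => hw j (hj.trans (Nat.le_succ J))
    have h2 : pathAvg n (fun e => ∑ t, sgn (e t) * w (J + 1) e t)
        - pathAvg n (fun e => ∑ t, sgn (e t) * w J e t)
        ≤ 3 * (β / 2 ^ (J + 1)) * √(h (J + 1))
          * (κ / 2 * pathAvg n (fun e => ∑ t, N e t ^ 2) + 2 / κ) := by
      refine le_of_forall_tradeoff (by positivity) (hh _) hκ fun μ hμ => ?_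
      have h3 := (hw J (Nat.le_succ J)).link (hw (J + 1) le_rfl) hμ
      have h4 : β / 2 ^ J + β / 2 ^ (J + 1) = 3 * (β / 2 ^ (J + 1)) := by
        rw [pow_succ]; field_simp; norm_num
      rw [h4] at h3
      have h5 : (h J + h (J + 1)) / μ ≤ 2 * h (J + 1) / μ := by
        have := hmono J (Nat.lt_succ_self J)
        gcongr
        linarith
      linarith
    rw [Finset.sum_range_succ]
    linarith

end Chaining

/-! ### Dyadic sums and the entropy integral. -/

section Integral

/-- Comparison of a dyadic sum with the integral of an antitone function. -/
theorem dyadic_sum_le_lintegral {H : ℝ → ℝ≥0∞} (hH : Antitone H) {β : ℝ} (hβ : 0 < β) (J : ℕ) :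
    ∑ j ∈ Finset.range J, ENNReal.ofReal (β / 2 ^ (j + 1)) * H (β / 2 ^ (j + 1))
      ≤ 2 * ∫⁻ ε in Set.Ioc (β / 2 ^ (J + 1)) (β / 2), H ε := by
  induction J with
  | zero => simp
  | succ J ih =>
    have hle : β / 2 ^ (J + 1 + 1) ≤ β / 2 ^ (J + 1) := by
      gcongr <;> norm_num
    have hle' : β / 2 ^ (J + 1) ≤ β / 2 := by
      have : (2 : ℝ) ^ 1 ≤ 2 ^ (J + 1) := by gcongr <;> norm_num
      gcongr
      simpa using this
    rw [Finset.sum_range_succ, ← Set.Ioc_union_Ioc_eq_Ioc hle hle',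
      lintegral_union measurableSet_Ioc (Set.Ioc_disjoint_Ioc_of_le le_rfl), mul_add, add_comm]
    refine add_le_add ?_ ih
    -- The interval below the scale β/2^(J+1) has half its length, whence the factor 2.
    calc ENNReal.ofReal (β / 2 ^ (J + 1)) * H (β / 2 ^ (J + 1))
        = 2 * (H (β / 2 ^ (J + 1)) * volume (Set.Ioc (β / 2 ^ (J + 1 + 1)) (β / 2 ^ (J + 1)))) := by
          rw [Real.volume_Ioc]
          have : β / 2 ^ (J + 1) = 2 * (β / 2 ^ (J + 1) - β / 2 ^ (J + 1 + 1)) := by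
            rw [pow_succ (2 : ℝ) (J + 1)]; field_simp; norm_num
          conv_lhs => arg 1; rw [this]
          rw [ENNReal.ofReal_mul zero_le_two]
          simp only [ENNReal.ofReal_ofNat]
          ring
      _ = 2 * ∫⁻ _ in Set.Ioc (β / 2 ^ (J + 1 + 1)) (β / 2 ^ (J + 1)), H (β / 2 ^ (J + 1)) := by
          rw [setLIntegral_const]
      _ ≤ _ := by
          gcongr 2 * ?_
          exact setLIntegral_mono' measurableSet_Ioc fun ε hε => hH hε.2

/-- An antitone function with finite integral on `[α, β]` is finite on `(α, β]`. -/
theorem ne_top_of_lintegral_ne_top {H : ℝ → ℝ≥0∞} (hH : Antitone H) {α β ε : ℝ} (hα : α < ε)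
    (hβ : ε ≤ β) (hint : ∫⁻ ε in Set.Icc α β, H ε ≠ ⊤) : H ε ≠ ⊤ := by
  intro h
  refine hint (top_le_iff.1 ?_)
  calc (⊤ : ℝ≥0∞) = ∫⁻ _ in Set.Ioc α ε, ⊤ := by
        rw [setLIntegral_const, Real.volume_Ioc, ENNReal.top_mul]
        simpa using hα
    _ ≤ ∫⁻ s in Set.Ioc α ε, H s :=
        setLIntegral_mono' measurableSet_Ioc fun s hs => h ▸ hH hs.2
    _ ≤ _ := lintegral_mono_set (Set.Ioc_subset_Icc_self.trans (Set.Icc_subset_Icc_right hβ))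

/-- The first clause bounds the final approximation error; the second keeps the intervals of the
integral comparison, which reach down to half a scale, above `α`. Minimality of `J` gives both. -/
theorem exists_dyadic_scale {α β : ℝ} (hα : 0 < α) :
    ∃ J : ℕ, β / 2 ^ J ≤ 4 * α ∧ ∀ j < J, α < β / 2 ^ (j + 1 + 1) := by
  have hex : ∃ J : ℕ, β / 2 ^ J ≤ 4 * α := by
    obtain ⟨J, hJ⟩ := pow_unbounded_of_one_lt (β / (4 * α)) one_lt_two
    refine ⟨J, ?_⟩
    rw [div_lt_iff₀ (by positivity)] at hJ
    rw [div_le_iff₀ (by positivity)]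
    linarith
  classical
  refine ⟨Nat.find hex, Nat.find_spec hex, fun j hj => ?_⟩
  have := Nat.find_min hex hj
  rw [not_le, lt_div_iff₀ (by positivity)] at this
  rw [lt_div_iff₀ (by positivity), pow_succ, pow_succ]
  linarith

end Integral

/-! ### Lipschitz bounds for the deflated loss. -/

section Truncation

/-- The deflated loss of the truncation to `[0, M]`. -/
noncomputable def truncDeflate (c M z : ℝ) : ℝ := deflate c (max 0 (min z M))

theorem truncDeflate_of_mem {c M z : ℝ} (h0 : 0 ≤ z) (hM : z ≤ M) :
    truncDeflate c M z = deflate c z := by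
  rw [truncDeflate, min_eq_left hM, max_eq_right h0]

/-- The slope 1 - cz lies in [-1, 1] on [0, M] because cM ≤ 2. The truncation is needed since cover
trees may take values outside `S`. -/
theorem abs_truncDeflate_sub_le {c M : ℝ} (hc : 0 ≤ c) (hM : 0 ≤ M) (hcM : c * M ≤ 2) (y z : ℝ) :
    |truncDeflate c M y - truncDeflate c M z| ≤ |y - z| := by
  have hmem : ∀ a : ℝ, 0 ≤ max 0 (min a M) ∧ max 0 (min a M) ≤ M := fun a =>
    ⟨le_max_left _ _, max_le hM (min_le_right _ _)⟩
  have hlip : |max 0 (min y M) - max 0 (min z M)| ≤ |y - z| := by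
    have h1 := abs_max_sub_max_le_max 0 (min y M) 0 (min z M)
    have h2 := abs_min_sub_min_le_max y M z M
    simp only [sub_self, abs_zero, abs_nonneg, sup_of_le_right, sup_of_le_left] at h1 h2
    exact h1.trans h2
  refine le_trans ?_ hlip
  obtain ⟨ha, ha'⟩ := hmem y
  obtain ⟨hb, hb'⟩ := hmem z
  rw [truncDeflate, truncDeflate]
  generalize max 0 (min y M) = a at *
  generalize max 0 (min z M) = b at *
  have h1 : deflate c a - deflate c b = (a - b) * (1 - c / 2 * (a + b)) := by
    unfold deflate; ring
  rw [h1, abs_mul]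
  refine mul_le_of_le_one_right (abs_nonneg _) ?_
  have h2 : c * (a + b) ≤ c * (M + M) := mul_le_mul_of_nonneg_left (by linarith) hc
  have h3 : 0 ≤ c * (a + b) := mul_nonneg hc (by linarith)
  rw [abs_le]
  constructor <;> linarith

theorem abs_truncDeflate_le {c M : ℝ} (hc : 0 ≤ c) (hM : 0 ≤ M) (hcM : c * M ≤ 2) (z : ℝ) :
    |truncDeflate c M z| ≤ |z| := by
  have h := abs_truncDeflate_sub_le hc hM hcM z 0
  rwa [truncDeflate_of_mem le_rfl hM, show deflate c 0 = 0 by simp [deflate], sub_zero,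
    sub_zero] at h

theorem abs_dotProduct_sub_le {K : ℕ} (v w l : Fin K → ℝ) :
    |v ⬝ᵥ l - w ⬝ᵥ l| ≤ ‖v - w‖ * l1norm l := by
  rw [← sub_dotProduct, dotProduct, l1norm, Finset.mul_sum]
  refine (Finset.abs_sum_le_sum_abs _ _).trans (Finset.sum_le_sum fun a _ => ?_)
  rw [abs_mul]
  exact mul_le_mul_of_nonneg_right (norm_le_pi_norm (v - w) a) (abs_nonneg _)

theorem l1norm_nonneg {K : ℕ} (l : Fin K → ℝ) : 0 ≤ l1norm l :=
  Finset.sum_nonneg fun a _ => abs_nonneg (l a)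

end Truncation

/-! ### From sequential covers to the offset bound. -/

section CoverApprox

variable {X : Type*} {K n : ℕ} {G : Set (X → Fin K → ℝ)} {c M σ ε : ℝ}
  {x : (Fin n → Bool) → Fin n → X} {o : (Fin n → Bool) → Fin n → Fin K → ℝ}
  {g : (Fin n → Bool) → X → Fin K → ℝ}

/-- The comparator `g e` may depend on the whole path: a cover is chosen path by path, and only the
index `i e` looks ahead. -/
theorem exists_cover_selection (hx : Predictable x) (hg : ∀ e, g e ∈ G)
    (h : seqEntropy ε G n ≠ ⊤) :
    ∃ (m : ℕ) (u : Fin m → Tree (Fin K → ℝ) n) (i : (Fin n → Bool) → Fin m),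
      Real.log m ≤ (seqEntropy ε G n).toReal ∧
      ∀ e t, ‖g e (x e t) - (u (i e)).val e t‖ ≤ ε := by
  obtain ⟨xt, hxt⟩ := hx.exists_tree
  obtain ⟨m, u, hu, hm⟩ := exists_finite_cover h xt
  have h1 : ∀ e, ∃ i, ∀ t, ‖g e (x e t) - (u i).val e t‖ ≤ ε := by
    intro e
    obtain ⟨_, ⟨i, rfl⟩, hi⟩ := hu (g e) (hg e) e
    exact ⟨i, fun t => by rw [← hxt]; exact hi t⟩
  choose i hi using h1
  exact ⟨m, u, i, hm, hi⟩

theorem exists_isApprox (hx : Predictable x) (ho : Predictable o) (hg : ∀ e, g e ∈ G)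
    (hc : 0 ≤ c) (hM : 0 ≤ M) (hcM : c * M ≤ 2) (hσ : |σ| = 1)
    (hZ : ∀ e t, 0 ≤ g e (x e t) ⬝ᵥ o e t ∧ g e (x e t) ⬝ᵥ o e t ≤ M)
    (h : seqEntropy ε G n ≠ ⊤) :
    ∃ w, IsApprox (fun e t => σ * deflate c (g e (x e t) ⬝ᵥ o e t)) (fun e t => l1norm (o e t))
      ε (seqEntropy ε G n).toReal w := by
  obtain ⟨m, u, i, hm, hi⟩ := exists_cover_selection hx hg h
  refine ⟨fun e t => σ * truncDeflate c M ((u (i e)).val e t ⬝ᵥ o e t), m,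
    fun k e t => σ * truncDeflate c M ((u k).val e t ⬝ᵥ o e t), i, fun k => ?_, fun _ _ => rfl, hm,
    fun e t => ?_⟩
  · exact (u k).predictable_val.map₂ ho fun a b => σ * truncDeflate c M (a ⬝ᵥ b)
  · rw [← mul_sub, abs_mul, hσ, one_mul, ← truncDeflate_of_mem (hZ e t).1 (hZ e t).2]
    refine (abs_truncDeflate_sub_le hc hM hcM _ _).trans ((abs_dotProduct_sub_le _ _ _).trans ?_)
    rw [norm_sub_rev]
    exact mul_le_mul_of_nonneg_right (hi e t) (l1norm_nonneg _)

/-- The approximation at the coarsest scale can be chosen from below. -/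
theorem exists_isApprox_root (hx : Predictable x) (ho : Predictable o) (hg : ∀ e, g e ∈ G)
    (hc : 0 ≤ c) (hM : 0 ≤ M) (hcM : c * M ≤ 2) (hσ : |σ| = 1)
    (hg0 : ∀ e x a, 0 ≤ g e x a) (ho0 : ∀ e t a, 0 ≤ o e t a)
    (hZ : ∀ e t, 0 ≤ g e (x e t) ⬝ᵥ o e t ∧ g e (x e t) ⬝ᵥ o e t ≤ M)
    (hε : 0 ≤ ε) (h : seqEntropy (ε / 2) G n ≠ ⊤) :
    ∃ w, IsApprox (fun e t => σ * deflate c (g e (x e t) ⬝ᵥ o e t)) (fun e t => l1norm (o e t))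
      ε (seqEntropy (ε / 2) G n).toReal w ∧ ∀ e t, |w e t| ≤ g e (x e t) ⬝ᵥ o e t := by
  obtain ⟨m, u, i, hm, hi⟩ := exists_cover_selection hx hg h
  -- Shifting an ε/2-accurate cover down by ε/2 and clipping at 0 places each selected coordinate
  -- between g - ε and g. This is why the entropy is taken at `ε / 2`.
  set v : Fin m → (Fin n → Bool) → Fin n → Fin K → ℝ :=
    fun k e t a => max 0 ((u k).val e t a - ε / 2) with hv
  have hcoord : ∀ e t a, 0 ≤ v (i e) e t a ∧ v (i e) e t a ≤ g e (x e t) a ∧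
      g e (x e t) a - ε ≤ v (i e) e t a := by
    intro e t a
    have h1 := (norm_le_pi_norm _ a).trans (hi e t)
    rw [Pi.sub_apply, Real.norm_eq_abs, abs_le] at h1
    refine ⟨le_max_left _ _, max_le (hg0 _ _ _) (by linarith), le_trans ?_ (le_max_right _ _)⟩
    linarith
  refine ⟨fun e t => σ * truncDeflate c M (v (i e) e t ⬝ᵥ o e t), ⟨m,
    fun k e t => σ * truncDeflate c M (v k e t ⬝ᵥ o e t), i, fun k => ?_, fun _ _ => rfl, hm,
    fun e t => ?_⟩, fun e t => ?_⟩
  · exact (u k).predictable_val.map₂ ho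
      fun a b => σ * truncDeflate c M ((fun j => max 0 (a j - ε / 2)) ⬝ᵥ b)
  · rw [← mul_sub, abs_mul, hσ, one_mul, ← truncDeflate_of_mem (hZ e t).1 (hZ e t).2]
    refine (abs_truncDeflate_sub_le hc hM hcM _ _).trans ((abs_dotProduct_sub_le _ _ _).trans ?_)
    refine mul_le_mul_of_nonneg_right ?_ (l1norm_nonneg _)
    refine (pi_norm_le_iff_of_nonneg hε).2 fun a => ?_
    obtain ⟨-, h2, h3⟩ := hcoord e t a
    rw [Pi.sub_apply, Real.norm_eq_abs, abs_le]
    constructor <;> linarith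
  · rw [abs_mul, hσ, one_mul]
    refine (abs_truncDeflate_le hc hM hcM _).trans ?_
    rw [abs_of_nonneg]
    · exact Finset.sum_le_sum fun a _ => mul_le_mul_of_nonneg_right (hcoord e t a).2.1 (ho0 e t a)
    · exact Finset.sum_nonneg fun a _ => mul_nonneg (hcoord e t a).1 (ho0 e t a)

/-- The chaining bound for the offset process of a class. -/
theorem pathAvg_offset_le (hx : Predictable x) (ho : Predictable o) (hg : ∀ e, g e ∈ G)
    (hc : 0 < c) (hM : 0 ≤ M) (hcM : c * M ≤ 2) (hσ : |σ| = 1)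
    (hg0 : ∀ e x a, 0 ≤ g e x a) (ho0 : ∀ e t a, 0 ≤ o e t a)
    (hZ : ∀ e t, 0 ≤ g e (x e t) ⬝ᵥ o e t ∧ g e (x e t) ⬝ᵥ o e t ≤ M)
    {α β κ : ℝ} (hβ : 0 < β) (hκ : 0 < κ) {J : ℕ} (hJ : β / 2 ^ J ≤ 4 * α)
    (hroot : seqEntropy (β / 2) G n ≠ ⊤) (hfin : ∀ j < J, seqEntropy (β / 2 ^ (j + 1)) G n ≠ ⊤) :
    pathAvg n (fun e => ∑ t, (sgn (e t) * (σ * deflate c (g e (x e t) ⬝ᵥ o e t))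
        - c / 2 * (g e (x e t) ⬝ᵥ o e t) ^ 2))
      ≤ (seqEntropy (β / 2) G n).toReal / c
        + 3 * (∑ j ∈ Finset.range J,
            β / 2 ^ (j + 1) * √(seqEntropy (β / 2 ^ (j + 1)) G n).toReal)
          * (κ / 2 * pathAvg n (fun e => ∑ t, l1norm (o e t) ^ 2) + 2 / κ)
        + 4 * α * pathAvg n (fun e => ∑ t, l1norm (o e t)) := by
  set Z : (Fin n → Bool) → Fin n → ℝ := fun e t => g e (x e t) ⬝ᵥ o e t with hZdef
  set Y : (Fin n → Bool) → Fin n → ℝ := fun e t => σ * deflate c (Z e t) with hY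
  set N : (Fin n → Bool) → Fin n → ℝ := fun e t => l1norm (o e t) with hN
  -- Levels 0 and 1 share the entropy at β/2, since the one-sided root has accuracy β only.
  let h : ℕ → ℝ := fun j => Nat.casesOn j (seqEntropy (β / 2) G n).toReal
    fun j => (seqEntropy (β / 2 ^ (j + 1)) G n).toReal
  have hw : ∀ j, ∃ w, j ≤ J → (IsApprox Y N (β / 2 ^ j) (h j) w ∧
      (j = 0 → ∀ e t, |w e t| ≤ Z e t)) := by
    intro j
    cases j with
    | zero =>
      obtain ⟨w, hw, hwZ⟩ := exists_isApprox_root hx ho hg hc.le hM hcM hσ hg0 ho0 hZ hβ.le hroot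
      exact ⟨w, fun _ => ⟨by rw [pow_zero, div_one]; exact hw, fun _ => hwZ⟩⟩
    | succ j =>
      by_cases hj : j + 1 ≤ J
      · obtain ⟨w, hw⟩ := exists_isApprox hx ho hg hc.le hM hcM hσ hZ (hfin j hj)
        exact ⟨w, fun _ => ⟨hw, fun h0 => absurd h0 (Nat.succ_ne_zero j)⟩⟩
      · exact ⟨fun _ _ => 0, fun h0 => absurd h0 hj⟩
  choose w hw using hw
  have hmono : ∀ j < J, h j ≤ h (j + 1) := by
    intro j hj
    cases j with
    | zero => exact le_of_eq (by simp [h])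
    | succ j =>
      refine ENNReal.toReal_mono (hfin _ hj) (seqEntropy_antitone G n ?_)
      gcongr
      · norm_num
      · omega
  have h1 := chaining hβ hκ (h := h) (fun j => by cases j <;> exact ENNReal.toReal_nonneg) hmono
    (fun j hj => (hw j hj).1)
  -- With μ = c the variance term is exactly the offset (c/2)∑Z², which cancels it.
  have h2 := (hw 0 (Nat.zero_le J)).1.root ((hw 0 (Nat.zero_le J)).2 rfl) hc
  change _ ≤ _ + (seqEntropy (β / 2) G n).toReal / c at h2
  have h3 : pathAvg n (fun e => ∑ t, sgn (e t) * Y e t)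
      ≤ pathAvg n (fun e => ∑ t, sgn (e t) * w J e t)
        + 4 * α * pathAvg n (fun e => ∑ t, N e t) := by
    rw [← pathAvg_mul_left, ← pathAvg_add]
    refine pathAvg_mono fun e => ?_
    rw [Finset.mul_sum, ← Finset.sum_add_distrib]
    refine Finset.sum_le_sum fun t _ => ?_
    obtain ⟨-, -, -, -, -, -, happ⟩ := (hw J le_rfl).1
    have h4 := (happ e t).trans (mul_le_mul_of_nonneg_right hJ (l1norm_nonneg _))
    rw [abs_le] at h4
    unfold sgn
    split_ifs <;> linarith [h4.1, h4.2]
  have h5 : pathAvg n (fun e => ∑ t, (sgn (e t) * Y e t - c / 2 * Z e t ^ 2))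
      = pathAvg n (fun e => ∑ t, sgn (e t) * Y e t)
        - c / 2 * pathAvg n (fun e => ∑ t, Z e t ^ 2) := by
    rw [← pathAvg_mul_left, ← pathAvg_sub]
    simp only [Finset.sum_sub_distrib, Finset.mul_sum]
  rw [h5]
  have h6 : ∑ j ∈ Finset.range J, β / 2 ^ (j + 1) * √(h (j + 1)) = ∑ j ∈ Finset.range J,
      β / 2 ^ (j + 1) * √(seqEntropy (β / 2 ^ (j + 1)) G n).toReal := rfl
  rw [h6] at h1
  change _ ≤ _ + _ * (_ * pathAvg n (fun e => ∑ t, N e t ^ 2) + _) + _ * pathAvg n (fun e => ∑ t, N e t)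
  linarith

end CoverApprox

/-- The dyadic entropy sum is at most twice the entropy integral. -/
theorem dyadic_sum_le_integral {X : Type*} {K : ℕ} (G : Set (X → Fin K → ℝ)) (n : ℕ) {α β : ℝ}
    (hβ : 0 < β) {J : ℕ} (hJ : ∀ j < J, α < β / 2 ^ (j + 1 + 1))
    (hint : ∫⁻ ε in Set.Icc α β, (seqEntropy ε G n) ^ (1 / 2 : ℝ) ≠ ⊤) :
    ∑ j ∈ Finset.range J, β / 2 ^ (j + 1) * √(seqEntropy (β / 2 ^ (j + 1)) G n).toReal
      ≤ 2 * (∫⁻ ε in Set.Icc α β, (seqEntropy ε G n) ^ (1 / 2 : ℝ)).toReal := by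
  rcases Nat.eq_zero_or_pos J with rfl | hpos
  · simp
  have hanti : Antitone fun ε => (seqEntropy ε G n) ^ (1 / 2 : ℝ) := fun a b hab =>
    ENNReal.rpow_le_rpow (seqEntropy_antitone G n hab) (by norm_num)
  have h1 := dyadic_sum_le_lintegral hanti hβ J
  have hαJ : α ≤ β / 2 ^ (J + 1) := by
    obtain ⟨j, rfl⟩ := Nat.exists_eq_add_of_lt hpos
    simpa using (hJ j (by omega)).le
  have h2 : ∫⁻ ε in Set.Ioc (β / 2 ^ (J + 1)) (β / 2), (seqEntropy ε G n) ^ (1 / 2 : ℝ)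
      ≤ ∫⁻ ε in Set.Icc α β, (seqEntropy ε G n) ^ (1 / 2 : ℝ) :=
    lintegral_mono_set (Set.Ioc_subset_Icc_self.trans (Set.Icc_subset_Icc hαJ (by linarith)))
  have h3 := ENNReal.toReal_mono (ENNReal.mul_ne_top ENNReal.ofNat_ne_top hint)
    (h1.trans (mul_le_mul_right h2 2))
  rw [ENNReal.toReal_mul, ENNReal.toReal_ofNat] at h3
  refine le_trans (le_of_eq ?_) h3
  rw [ENNReal.toReal_sum]
  · refine Finset.sum_congr rfl fun j _ => ?_
    rw [ENNReal.toReal_mul, ENNReal.toReal_ofReal (by positivity), ← ENNReal.toReal_rpow,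
      Real.sqrt_eq_rpow]
  · intro j hj
    refine ENNReal.mul_ne_top ENNReal.ofReal_ne_top (ne_top_of_lintegral_ne_top hanti ?_ ?_ hint)
    · refine (hJ j (Finset.mem_range.1 hj)).trans_le ?_
      gcongr
      · norm_num
      · omega
    · exact div_le_self hβ.le (one_le_pow₀ one_le_two)

/-! ### Solving one round and assembling the algorithm. -/

section Play

variable {X : Type*} {K : ℕ} {S L : Set (Fin K → ℝ)} {G : Set (X → Fin K → ℝ)} {R B c : ℝ}

/-- The loss of a comparator from `G` in a context, for an outcome in `L`. -/
def comparatorLoss (G : Set (X → Fin K → ℝ)) (L : Set (Fin K → ℝ)) (x : X) (l : L) (g : G) : ℝ :=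
  (g : X → Fin K → ℝ) x ⬝ᵥ (l : Fin K → ℝ)

theorem dotProduct_mem_Icc (hS : ∀ s ∈ S, ∀ a, 0 ≤ s a) (hL : ∀ l ∈ L, ∀ a, 0 ≤ l a)
    (hB : 0 ≤ B) (hLR : ∀ l ∈ L, l1norm l ≤ R) (hSB : ∀ s ∈ S, ‖s‖ ≤ B)
    {s l : Fin K → ℝ} (hs : s ∈ S) (hl : l ∈ L) : 0 ≤ s ⬝ᵥ l ∧ s ⬝ᵥ l ≤ R * B := by
  refine ⟨Finset.sum_nonneg fun a _ => mul_nonneg (hS s hs a) (hL l hl a), ?_⟩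
  have h := abs_dotProduct_sub_le s 0 l
  rw [zero_dotProduct, sub_zero, sub_zero] at h
  calc s ⬝ᵥ l ≤ ‖s‖ * l1norm l := (le_abs_self _).trans h
    _ ≤ B * R := mul_le_mul (hSB s hs) (hLR l hl) (l1norm_nonneg l) hB
    _ = R * B := mul_comm _ _

theorem abs_deflate_le {M z : ℝ} (hc : 0 ≤ c) (h0 : 0 ≤ z) (hM : z ≤ M) :
    |deflate c z| ≤ M + c / 2 * M ^ 2 := by
  have h1 : c / 2 * z ^ 2 ≤ c / 2 * M ^ 2 := by gcongr
  have h2 : 0 ≤ c / 2 * z ^ 2 := by positivity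
  rw [deflate, abs_le]
  constructor <;> linarith

theorem abs_increment_le {γ O : Type*} {Z : X → O → γ → ℝ} {M : ℝ} (hc : 0 ≤ c)
    (hZ : ∀ x o g, 0 ≤ Z x o g ∧ Z x o g ≤ M) (x : X) (o o' : O) (g : γ) :
    |increment Z c x o o' g| ≤ 2 * (M + c / 2 * M ^ 2) + c * M ^ 2 := by
  have h1 := abs_le.1 (abs_deflate_le hc (hZ x o g).1 (hZ x o g).2)
  have h2 := abs_le.1 (abs_deflate_le hc (hZ x o' g).1 (hZ x o' g).2)
  have hsq : ∀ o, 0 ≤ c / 2 * Z x o g ^ 2 ∧ c / 2 * Z x o g ^ 2 ≤ c / 2 * M ^ 2 := fun o => by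
    have := (hZ x o g).1
    have := (hZ x o g).2
    constructor
    · positivity
    · gcongr
  have h3 := hsq o
  have h4 := hsq o'
  rw [increment, abs_le]
  constructor <;> linarith [h1.1, h1.2, h2.1, h2.2, h3.1, h3.2, h4.1, h4.2]

theorem abs_dotProduct_sub_right_le {s l l' : Fin K → ℝ} (hsB : ‖s‖ ≤ B) :
    |s ⬝ᵥ l - s ⬝ᵥ l'| ≤ B * K * ‖l - l'‖ := by
  rw [← dotProduct_sub, dotProduct]
  refine (Finset.abs_sum_le_sum_abs _ _).trans ?_
  calc ∑ a, |s a * (l - l') a| ≤ ∑ _a : Fin K, B * ‖l - l'‖ := by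
        refine Finset.sum_le_sum fun a _ => ?_
        rw [abs_mul]
        exact mul_le_mul ((norm_le_pi_norm s a).trans hsB) (norm_le_pi_norm (l - l') a)
          (abs_nonneg _) ((norm_nonneg s).trans hsB)
    _ = B * K * ‖l - l'‖ := by
        rw [Finset.sum_const, Finset.card_univ, Fintype.card_fin, nsmul_eq_mul]
        ring

theorem norm_le_l1norm (l : Fin K → ℝ) : ‖l‖ ≤ l1norm l :=
  (pi_norm_le_iff_of_nonneg (l1norm_nonneg l)).2 fun a =>
    Finset.single_le_sum (f := fun a => |l a|) (fun _ _ => abs_nonneg _) (Finset.mem_univ a)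

theorem measurable_dotProduct (l : Fin K → ℝ) : Measurable fun s : S => (s : Fin K → ℝ) ⬝ᵥ l := by
  exact Finset.measurable_sum _ fun i _ =>
    ((measurable_pi_apply i).comp measurable_subtype_coe).mul_const _

/-- One round of the game: some distribution on `S` guarantees the value of the symmetrized game
up to `δ`. -/
theorem exists_play (hS : ∀ s ∈ S, ∀ a, 0 ≤ s a) (hL : ∀ l ∈ L, ∀ a, 0 ≤ l a)
    (hG : G.Nonempty) (hGS : ∀ g ∈ G, ∀ x, g x ∈ S) (hB : 0 ≤ B)
    (hLR : ∀ l ∈ L, l1norm l ≤ R) (hSB : ∀ s ∈ S, ‖s‖ ≤ B) (hc : 0 ≤ c)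
    {ρ : L → ℝ} {P : ℝ} (hρ : ∀ l, |ρ l| ≤ P) {F : G → ℝ} {M : ℝ} (hF : ∀ g, |F g| ≤ M) (n : ℕ)
    {δ : ℝ} (hδ : 0 < δ) (x : X) :
    ∃ p : ProbabilityMeasure S, ∀ l : L,
      ∫ s : S, ((s : Fin K → ℝ) ⬝ᵥ (l : Fin K → ℝ) - c * ((s : Fin K → ℝ) ⬝ᵥ (l : Fin K → ℝ)) ^ 2)
          ∂(p : Measure S) - ρ l
        + gameValue (comparatorLoss G L) c ρ n (F - comparatorLoss G L x l)
      ≤ gameValue (comparatorLoss G L) c ρ (n + 1) F + δ := by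
  have : Nonempty G := hG.to_subtype
  obtain ⟨g₀, hg₀⟩ := hG
  have : Nonempty S := ⟨⟨g₀ x, hGS g₀ hg₀ x⟩⟩
  have hmem : ∀ (s : S) (l : L), 0 ≤ (s : Fin K → ℝ) ⬝ᵥ (l : Fin K → ℝ) ∧
      (s : Fin K → ℝ) ⬝ᵥ (l : Fin K → ℝ) ≤ R * B := fun s l =>
    dotProduct_mem_Icc hS hL hB hLR hSB s.2 l.2
  have hZ : ∀ x (l : L) (g : G), 0 ≤ comparatorLoss G L x l g ∧
      comparatorLoss G L x l g ≤ R * B := fun x l g => hmem ⟨g.1 x, hGS g.1 g.2 x⟩ l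
  have hD := abs_increment_le hc hZ
  set f : S → L → ℝ := fun s l => (s : Fin K → ℝ) ⬝ᵥ (l : Fin K → ℝ)
    - c * ((s : Fin K → ℝ) ⬝ᵥ (l : Fin K → ℝ)) ^ 2 with hf
  set Φ : L → ℝ := fun l => - ρ l + gameValue (comparatorLoss G L) c ρ n
    (F - comparatorLoss G L x l) with hΦ
  obtain ⟨M', hM'⟩ := gameValue_bounded hD hρ n (M + R * B)
  have hΦb : ∀ l, |Φ l| ≤ P + M' := fun l =>
    (abs_add_le _ _).trans (add_le_add ((abs_neg _).le.trans (hρ l)) (hM' _ fun g =>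
      (abs_sub _ _).trans (add_le_add (hF g) (abs_le.2
        ⟨by linarith [(hZ x l g).1, (hZ x l g).2], (hZ x l g).2⟩))))
  have hfm : ∀ l, Measurable fun s => f s l := fun l =>
    (measurable_dotProduct _).sub (((measurable_dotProduct _).pow_const 2).const_mul c)
  have hfb : ∀ s l, |f s l| ≤ R * B + c * (R * B) ^ 2 := by
    intro s l
    obtain ⟨h1, h2⟩ := hmem s l
    have h3 : c * ((s : Fin K → ℝ) ⬝ᵥ (l : Fin K → ℝ)) ^ 2 ≤ c * (R * B) ^ 2 := by gcongr
    have h4 : 0 ≤ c * ((s : Fin K → ℝ) ⬝ᵥ (l : Fin K → ℝ)) ^ 2 := by positivity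
    rw [hf, abs_le]
    constructor <;> dsimp only <;> linarith
  -- A Lipschitz constant of the payoff in the outcome, plus 1 for the coordinate `Φ` of the net.
  set A : ℝ := B * K * (1 + 2 * (c * (R * B))) + 1 with hA
  have hRB : 0 ≤ c * (R * B) ∨ IsEmpty L := by
    rcases isEmpty_or_nonempty L with h | ⟨⟨l⟩⟩
    · exact Or.inr h
    · exact Or.inl (mul_nonneg hc ((hZ x l ⟨g₀, hg₀⟩).1.trans (hZ x l ⟨g₀, hg₀⟩).2))
  rcases hRB with hRB | hempty
  swap
  · exact ⟨⟨Measure.dirac (Classical.arbitrary S), inferInstance⟩, fun l => hempty.elim l⟩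
  have hApos : 0 < A := by positivity
  -- Taking `Φ l` as a coordinate makes the net control the game value without any continuity in the
  -- outcome.
  obtain ⟨N, hN, hnet⟩ := exists_finite_net (fun l : L => ((l : Fin K → ℝ), Φ l))
    (by
      refine (Metric.isBounded_iff_subset_closedBall 0).2 ⟨max R (P + M'), ?_⟩
      rintro _ ⟨l, rfl⟩
      rw [mem_closedBall_zero_iff, Prod.norm_def]
      exact max_le_max ((norm_le_l1norm _).trans (hLR l l.2)) (hΦb l))
    (show 0 < δ / 2 / A by positivity)
  obtain ⟨p, hp⟩ := exists_probabilityMeasure_forall_le (fun s l => f s l + Φ l)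
    (fun l => (hfm l).add_const _) (C := R * B + c * (R * B) ^ 2 + (P + M'))
    (fun s l => (abs_add_le _ _).trans (add_le_add (hfb s l) (hΦb l)))
    (δ := δ / 2) (v := gameValue (comparatorLoss G L) c ρ (n + 1) F + δ / 2) hN
    (by
      intro l
      obtain ⟨l', hl', hdist⟩ := hnet l
      refine ⟨l', hl', fun s => ?_⟩
      rw [Prod.dist_eq, max_lt_iff] at hdist
      obtain ⟨h1, h2⟩ := hdist
      rw [dist_eq_norm] at h1
      rw [Real.dist_eq] at h2
      have h3 : |f s l - f s l'| ≤ B * K * (1 + 2 * (c * (R * B))) * (δ / 2 / A) := by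
        obtain ⟨ha, ha'⟩ := hmem s l
        obtain ⟨hb, hb'⟩ := hmem s l'
        have h4 := abs_dotProduct_sub_right_le (l := l) (l' := l') (hSB s s.2)
        have h5 : f s l - f s l' = ((s : Fin K → ℝ) ⬝ᵥ (l : Fin K → ℝ)
            - (s : Fin K → ℝ) ⬝ᵥ (l' : Fin K → ℝ))
            * (1 - c * ((s : Fin K → ℝ) ⬝ᵥ (l : Fin K → ℝ)
              + (s : Fin K → ℝ) ⬝ᵥ (l' : Fin K → ℝ))) := by
          simp only [hf]; ring
        have h6 : |1 - c * ((s : Fin K → ℝ) ⬝ᵥ (l : Fin K → ℝ)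
              + (s : Fin K → ℝ) ⬝ᵥ (l' : Fin K → ℝ))| ≤ 1 + 2 * (c * (R * B)) := by
          have h7 := mul_le_mul_of_nonneg_left (add_le_add ha' hb') hc
          have h8 := mul_nonneg hc (add_nonneg ha hb)
          rw [abs_le]
          constructor <;> linarith
        rw [h5, abs_mul]
        calc _ ≤ (B * K * ‖(l : Fin K → ℝ) - l'‖) * (1 + 2 * (c * (R * B))) :=
              mul_le_mul h4 h6 (abs_nonneg _) (by positivity)
          _ ≤ (B * K * (δ / 2 / A)) * (1 + 2 * (c * (R * B))) := by gcongr
          _ = _ := by ring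
      have h4 : A * (δ / 2 / A) = δ / 2 := mul_div_cancel₀ _ hApos.ne'
      have h5 := (abs_le.1 h3).2
      have h6 := (abs_le.1 h2.le).2
      have h7 : A * (δ / 2 / A) = B * K * (1 + 2 * (c * (R * B))) * (δ / 2 / A) + δ / 2 / A := by
        rw [hA]; ring
      linarith)
    (by
      intro ι _ q o hq0 hq
      obtain ⟨s, hs⟩ := exists_response hD hρ (f := f) (x := x)
        (fun g => ⟨⟨g.1 x, hGS g.1 g.2 x⟩, fun o => rfl⟩) hq0 hq o hF n (half_pos hδ)
      refine ⟨s, lt_of_le_of_lt (le_of_eq (Finset.sum_congr rfl fun i _ => ?_)) hs⟩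
      simp only [hΦ]
      ring)
  refine ⟨p, fun l => ?_⟩
  have h1 := hp l
  rw [integral_add (Integrable.of_bound (hfm l).aestronglyMeasurable (R * B + c * (R * B) ^ 2)
    (Filter.Eventually.of_forall fun s => hfb s l)) (integrable_const _)] at h1
  simp only [integral_const, probReal_univ, one_smul, hΦ] at h1
  linarith

theorem sum_integral_offset_eq {T : ℕ} (hS : ∀ s ∈ S, ∀ a, 0 ≤ s a) (hL : ∀ l ∈ L, ∀ a, 0 ≤ l a)
    (hB : 0 ≤ B) (hLR : ∀ l ∈ L, l1norm l ≤ R) (hSB : ∀ s ∈ S, ‖s‖ ≤ B)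
    (p : Algorithm X S) (x : Fin T → X) (l : Fin T → Fin K → ℝ) (hl : ∀ t, l t ∈ L) :
    ∑ t, ∫ s : S, ((s : Fin K → ℝ) ⬝ᵥ l t - c * ((s : Fin K → ℝ) ⬝ᵥ l t) ^ 2)
      ∂(p.play x l t : Measure S) = p.cumLoss x l - c * p.localNorm x l := by
  rw [Algorithm.cumLoss, Algorithm.localNorm, Finset.mul_sum, ← Finset.sum_sub_distrib]
  refine Finset.sum_congr rfl fun t _ => ?_
  have hmem : ∀ s : S, 0 ≤ (s : Fin K → ℝ) ⬝ᵥ l t ∧ (s : Fin K → ℝ) ⬝ᵥ l t ≤ R * B := fun s =>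
    dotProduct_mem_Icc hS hL hB hLR hSB s.2 (hl t)
  rw [integral_sub, integral_const_mul]
  · refine Integrable.of_bound (measurable_dotProduct _).aestronglyMeasurable (R * B)
      (Filter.Eventually.of_forall fun s => ?_)
    rw [Real.norm_of_nonneg (hmem s).1]
    exact (hmem s).2
  · refine (Integrable.of_bound ((measurable_dotProduct _).pow_const 2).aestronglyMeasurable
      ((R * B) ^ 2) (Filter.Eventually.of_forall fun s => ?_)).const_mul c
    rw [Real.norm_of_nonneg (sq_nonneg _)]
    exact pow_le_pow_left₀ (hmem s).1 (hmem s).2 2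

/-- The state of the game after a history: the negated cumulative losses of the comparators. -/
def historyState (G : Set (X → Fin K → ℝ)) {t : ℕ} (h : Fin t → X × (Fin K → ℝ)) (g : G) : ℝ :=
  -∑ i, (g : X → Fin K → ℝ) (h i).1 ⬝ᵥ (h i).2

theorem exists_historyState_bound (hGS : ∀ g ∈ G, ∀ x, g x ∈ S) (hSB : ∀ s ∈ S, ‖s‖ ≤ B) {t : ℕ}
    (h : Fin t → X × (Fin K → ℝ)) : ∃ M, ∀ g, |historyState G h g| ≤ M := by
  refine ⟨∑ i, B * l1norm (h i).2, fun g => ?_⟩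
  rw [historyState, abs_neg]
  refine (Finset.abs_sum_le_sum_abs _ _).trans (Finset.sum_le_sum fun i _ => ?_)
  have h1 := abs_dotProduct_sub_le (g.1 (h i).1) 0 (h i).2
  rw [zero_dotProduct, sub_zero, sub_zero] at h1
  exact h1.trans (mul_le_mul_of_nonneg_right (hSB _ (hGS g.1 g.2 _)) (l1norm_nonneg _))

theorem le_gameValue_zero {γ O : Type*} {Z : X → O → γ → ℝ} {ρ : O → ℝ} {F : γ → ℝ} {M : ℝ}
    (hF : ∀ g, |F g| ≤ M) (g : γ) : F g ≤ gameValue Z c ρ 0 F := by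
  refine le_csSup ⟨M, ?_⟩ ⟨fun F => F g, ⟨g, rfl⟩, rfl⟩
  rintro _ ⟨_, ⟨g, rfl⟩, rfl⟩
  exact (abs_le.1 (hF g)).2

/-- There is an algorithm whose penalized loss exceeds the loss of every comparator by at most the
value of the symmetrized game, up to `δ` in each round. -/
theorem exists_algorithm (T : ℕ) (hS : ∀ s ∈ S, ∀ a, 0 ≤ s a) (hL : ∀ l ∈ L, ∀ a, 0 ≤ l a)
    (hG : G.Nonempty) (hGS : ∀ g ∈ G, ∀ x, g x ∈ S) (hB : 0 ≤ B)
    (hLR : ∀ l ∈ L, l1norm l ≤ R) (hSB : ∀ s ∈ S, ‖s‖ ≤ B) (hc : 0 ≤ c)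
    {ρ : (Fin K → ℝ) → ℝ} {P : ℝ} (hρ : ∀ l ∈ L, |ρ l| ≤ P) {δ : ℝ} (hδ : 0 < δ) :
    ∃ p : Algorithm X S, ∀ (x : Fin T → X) (l : Fin T → Fin K → ℝ), (∀ t, l t ∈ L) → ∀ g ∈ G,
      p.cumLoss x l - c * p.localNorm x l ≤ ∑ t, g (x t) ⬝ᵥ l t + ∑ t, ρ (l t)
        + gameValue (comparatorLoss G L) c (fun l : L => ρ l) T 0 + T * δ := by
  -- With rounds counted from 0, `T - 1 - t` rounds remain after round `t`; the truncated
  -- subtraction for `t ≥ T` is never used.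
  have hex : ∀ (t : ℕ) (h : Fin t → X × (Fin K → ℝ)) (x : X), ∃ p : ProbabilityMeasure S, ∀ l : L,
      ∫ s : S, ((s : Fin K → ℝ) ⬝ᵥ (l : Fin K → ℝ) - c * ((s : Fin K → ℝ) ⬝ᵥ (l : Fin K → ℝ)) ^ 2)
          ∂(p : Measure S) - ρ l
        + gameValue (comparatorLoss G L) c (fun l : L => ρ l) (T - 1 - t)
          (historyState G h - comparatorLoss G L x l)
      ≤ gameValue (comparatorLoss G L) c (fun l : L => ρ l) (T - 1 - t + 1) (historyState G h)
        + δ := by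
    intro t h x
    obtain ⟨M, hM⟩ := exists_historyState_bound hGS hSB h
    exact exists_play hS hL hG hGS hB hLR hSB hc (ρ := fun l : L => ρ l)
      (fun l => hρ l l.2) hM (T - 1 - t) hδ x
  choose p hp using hex
  refine ⟨p, fun x l hl g hg => ?_⟩
  rw [← sum_integral_offset_eq hS hL hB hLR hSB p x l hl]
  set a : Fin T → ℝ := fun t => ∫ s : S, ((s : Fin K → ℝ) ⬝ᵥ l t
    - c * ((s : Fin K → ℝ) ⬝ᵥ l t) ^ 2) ∂(Algorithm.play p x l t : Measure S) with ha
  -- Potential argument: the penalized loss so far plus the value of the remaining game grows by at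
  -- most `δ` per round.
  have key : ∀ k (hk : k ≤ T), ∑ i : Fin k, (a (Fin.castLE hk i) - ρ (l (Fin.castLE hk i)))
      + gameValue (comparatorLoss G L) c (fun l : L => ρ l) (T - k)
        (historyState G fun i : Fin k => (x (Fin.castLE hk i), l (Fin.castLE hk i)))
      ≤ gameValue (comparatorLoss G L) c (fun l : L => ρ l) T 0 + k * δ := by
    intro k
    induction k with
    | zero =>
      intro hk
      have : (historyState G fun i : Fin 0 => (x (Fin.castLE hk i), l (Fin.castLE hk i))) = 0 := by
        funext g; simp [historyState]
      simp [this]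
    | succ k ih =>
      intro hk
      have h1 := ih (Nat.le_of_succ_le hk)
      have h2 := hp k (fun i => (x (Fin.castLE (Nat.le_of_succ_le hk) i),
        l (Fin.castLE (Nat.le_of_succ_le hk) i))) (x ⟨k, hk⟩) ⟨l ⟨k, hk⟩, hl _⟩
      rw [show T - 1 - k + 1 = T - k by omega, show T - 1 - k = T - (k + 1) by omega] at h2
      have h3 : (historyState G fun i : Fin (k + 1) => (x (Fin.castLE hk i), l (Fin.castLE hk i)))
          = (historyState G fun i : Fin k => (x (Fin.castLE (Nat.le_of_succ_le hk) i),
              l (Fin.castLE (Nat.le_of_succ_le hk) i)))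
            - comparatorLoss G L (x ⟨k, hk⟩) ⟨l ⟨k, hk⟩, hl _⟩ := by
        funext g
        simp only [historyState, Pi.sub_apply, comparatorLoss, Fin.sum_univ_castSucc, neg_add]
        rfl
      rw [h3, Fin.sum_univ_castSucc]
      have h4 : a (Fin.castLE hk (Fin.last k)) = ∫ s : S, ((s : Fin K → ℝ) ⬝ᵥ l ⟨k, hk⟩
          - c * ((s : Fin K → ℝ) ⬝ᵥ l ⟨k, hk⟩) ^ 2) ∂(p k (fun i =>
            (x (Fin.castLE (Nat.le_of_succ_le hk) i),
              l (Fin.castLE (Nat.le_of_succ_le hk) i))) (x ⟨k, hk⟩) : Measure S) := rfl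
      have h5 : l (Fin.castLE hk (Fin.last k)) = l ⟨k, hk⟩ := rfl
      rw [h4, h5]
      have h6 : ∑ i : Fin k, (a (Fin.castLE hk i.castSucc) - ρ (l (Fin.castLE hk i.castSucc)))
          = ∑ i : Fin k, (a (Fin.castLE (Nat.le_of_succ_le hk) i)
            - ρ (l (Fin.castLE (Nat.le_of_succ_le hk) i))) := rfl
      rw [h6]
      push_cast
      linarith
  have h1 := key T le_rfl
  rw [Nat.sub_self, Finset.sum_sub_distrib] at h1
  have h2 : -∑ t, g (x t) ⬝ᵥ l t ≤ gameValue (comparatorLoss G L) c (fun l : L => ρ l) 0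
      (historyState G fun i : Fin T => (x (Fin.castLE le_rfl i), l (Fin.castLE le_rfl i))) := by
    obtain ⟨M, hM⟩ := exists_historyState_bound hGS hSB
      fun i : Fin T => (x (Fin.castLE le_rfl i), l (Fin.castLE le_rfl i))
    have h3 := le_gameValue_zero (Z := comparatorLoss G L) (c := c) (ρ := fun l : L => ρ l) hM ⟨g, hg⟩
    refine le_trans (le_of_eq ?_) h3
    rfl
  simp only [Fin.castLE_rfl, id] at h1 h2
  linarith

end Play

/-! ### Bounding the value, and the case of a vanishing integral. -/

section Final

variable {X : Type*} {K : ℕ} {S L : Set (Fin K → ℝ)} {G : Set (X → Fin K → ℝ)} {R B c : ℝ}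

/-- The value of the symmetrized game is controlled by the entropies. -/
theorem gameValue_le (T : ℕ) (hS : ∀ s ∈ S, ∀ a, 0 ≤ s a) (hL : ∀ l ∈ L, ∀ a, 0 ≤ l a)
    (hGS : ∀ g ∈ G, ∀ x, g x ∈ S) (hB : 0 ≤ B) (hR : 0 ≤ R)
    (hLR : ∀ l ∈ L, l1norm l ≤ R) (hSB : ∀ s ∈ S, ‖s‖ ≤ B) (hc : 0 < c) (hcM : c * (R * B) ≤ 2)
    {α β κ : ℝ} (hα : 0 < α) (hαβ : α < β) (hκ : 0 < κ)
    (hroot : seqEntropy (β / 2) G T ≠ ⊤)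
    (hint : ∫⁻ ε in Set.Icc α β, (seqEntropy ε G T) ^ (1 / 2 : ℝ) ≠ ⊤) {I : ℝ}
    (hI : I = (∫⁻ ε in Set.Icc α β, (seqEntropy ε G T) ^ (1 / 2 : ℝ)).toReal) :
    gameValue (comparatorLoss G L) c
        (fun l : L => 8 * α * l1norm (l : Fin K → ℝ) + 6 * κ * I * l1norm (l : Fin K → ℝ) ^ 2) T 0
      ≤ 2 * (seqEntropy (β / 2) G T).toReal / c + 24 * I / κ := by
  have hI0 : 0 ≤ I := hI ▸ ENNReal.toReal_nonneg
  have hβ : 0 < β := hα.trans hαβ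
  set ρ : L → ℝ := fun l => 8 * α * l1norm (l : Fin K → ℝ)
    + 6 * κ * I * l1norm (l : Fin K → ℝ) ^ 2 with hρ
  obtain ⟨J, hJ, hJα⟩ := exists_dyadic_scale (β := β) hα
  have hsum := dyadic_sum_le_integral G T hβ hJα hint
  rw [← hI] at hsum
  have hfin : ∀ j < J, seqEntropy (β / 2 ^ (j + 1)) G T ≠ ⊤ := by
    intro j hj h0
    have hanti : Antitone fun ε => (seqEntropy ε G T) ^ (1 / 2 : ℝ) := fun a b hab =>
      ENNReal.rpow_le_rpow (seqEntropy_antitone G T hab) (by norm_num)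
    refine ne_top_of_lintegral_ne_top hanti (ε := β / 2 ^ (j + 1)) ?_ ?_ hint ?_
    · refine (hJα j hj).trans_le ?_
      gcongr
      · norm_num
      · omega
    · exact div_le_self hβ.le (one_le_pow₀ one_le_two)
    · simp [h0]
  refine Real.sSup_le ?_ (by positivity)
  rintro _ ⟨Λ, hΛ, rfl⟩
  obtain ⟨x, o, o', g, hx, ho, ho', hF⟩ := functionals_eq_pathAvg hΛ
  -- The two outcomes enter with opposite signs but obey the same bound. Half the penalty averages
  -- to 4αN + 3κIQ, which is what chaining leaves besides the entropy terms.
  have half : ∀ (σ : ℝ) (o : (Fin T → Bool) → Fin T → L), |σ| = 1 → Predictable o →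
      pathAvg T (fun e => ∑ t, (sgn (e t) * (σ * deflate c (comparatorLoss G L (x e t) (o e t) (g e)))
        - c / 2 * comparatorLoss G L (x e t) (o e t) (g e) ^ 2)) - pathAvg T (fun e => ∑ t, ρ (o e t) / 2)
      ≤ (seqEntropy (β / 2) G T).toReal / c + 12 * I / κ := by
    intro σ o hσ ho
    have h1 := pathAvg_offset_le (G := G) (M := R * B) (g := fun e => (g e : X → Fin K → ℝ)) hx
      (ho.map fun l => (l : Fin K → ℝ)) (fun e => (g e).2) hc (mul_nonneg hR hB) hcM hσ
      (fun e x a => hS _ (hGS _ (g e).2 x) a) (fun e t a => hL _ (o e t).2 a)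
      (fun e t => dotProduct_mem_Icc hS hL hB hLR hSB (hGS _ (g e).2 _) (o e t).2)
      hβ hκ hJ hroot hfin
    set Q := pathAvg T (fun e => ∑ t, l1norm (o e t : Fin K → ℝ) ^ 2) with hQ
    set N := pathAvg T (fun e => ∑ t, l1norm (o e t : Fin K → ℝ)) with hN
    have hQ0 : 0 ≤ Q := pathAvg_nonneg fun e => Finset.sum_nonneg fun t _ => sq_nonneg _
    have h2 : pathAvg T (fun e => ∑ t, ρ (o e t) / 2) = 4 * α * N + 3 * κ * I * Q := by
      rw [hQ, hN, ← pathAvg_mul_left, ← pathAvg_mul_left, ← pathAvg_add]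
      congr 1
      funext e
      rw [Finset.mul_sum, Finset.mul_sum, ← Finset.sum_add_distrib]
      exact Finset.sum_congr rfl fun t _ => by simp only [hρ]; ring
    rw [h2]
    have h3 := mul_le_mul_of_nonneg_right (mul_le_mul_of_nonneg_left hsum (zero_le_three (α := ℝ)))
      (show 0 ≤ κ / 2 * Q + 2 / κ by positivity)
    have h4 : 3 * (2 * I) * (κ / 2 * Q + 2 / κ) = 3 * κ * I * Q + 12 * I / κ := by
      field_simp
      ring
    rw [h4] at h3
    have h5 := h1.trans (add_le_add_left (add_le_add_right h3 _) _)
    have h6 : pathAvg T (fun e => ∑ t, (sgn (e t) * (σ * deflate c (comparatorLoss G L (x e t) (o e t) (g e)))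
        - c / 2 * comparatorLoss G L (x e t) (o e t) (g e) ^ 2)) ≤ _ := h5
    linarith
  have h1 := half 1 o' (by simp) ho'
  have h2 := half (-1) o (by simp) ho
  dsimp only
  rw [hF]
  have h3 : (fun e => (0 : G → ℝ) (g e) + ∑ t,
        (sgn (e t) * (deflate c (comparatorLoss G L (x e t) (o' e t) (g e))
            - deflate c (comparatorLoss G L (x e t) (o e t) (g e)))
          - c / 2 * (comparatorLoss G L (x e t) (o' e t) (g e) ^ 2
            + comparatorLoss G L (x e t) (o e t) (g e) ^ 2)
          - (ρ (o e t) + ρ (o' e t)) / 2))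
      = fun e => ((∑ t, (sgn (e t) * (1 * deflate c (comparatorLoss G L (x e t) (o' e t) (g e)))
            - c / 2 * comparatorLoss G L (x e t) (o' e t) (g e) ^ 2)) - ∑ t, ρ (o' e t) / 2)
        + ((∑ t, (sgn (e t) * (-1 * deflate c (comparatorLoss G L (x e t) (o e t) (g e)))
            - c / 2 * comparatorLoss G L (x e t) (o e t) (g e) ^ 2)) - ∑ t, ρ (o e t) / 2) := by
    funext e
    rw [Pi.zero_apply, zero_add, ← Finset.sum_sub_distrib, ← Finset.sum_sub_distrib,
      ← Finset.sum_add_distrib]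
    exact Finset.sum_congr rfl fun t _ => by ring
  rw [h3, pathAvg_add, pathAvg_sub, pathAvg_sub]
  have h4 : 2 * (seqEntropy (β / 2) G T).toReal / c + 24 * I / κ
      = ((seqEntropy (β / 2) G T).toReal / c + 12 * I / κ)
        + ((seqEntropy (β / 2) G T).toReal / c + 12 * I / κ) := by ring
  rw [h4]
  exact add_le_add h1 h2

theorem localNorm_nonneg (p : Algorithm X S) {T : ℕ} (x : Fin T → X) (l : Fin T → Fin K → ℝ) :
    0 ≤ p.localNorm x l :=
  Finset.sum_nonneg fun _ _ => integral_nonneg fun _ => sq_nonneg _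

theorem regret_le (hG : G.Nonempty) {p : Algorithm X S} {T : ℕ} {x : Fin T → X}
    {l : Fin T → Fin K → ℝ} {b : ℝ} (h : ∀ g ∈ G, p.cumLoss x l ≤ ∑ t, g (x t) ⬝ᵥ l t + b) :
    p.regret G x l ≤ b := by
  have : Nonempty G := hG.to_subtype
  have h1 : p.cumLoss x l - b ≤ ⨅ g : G, ∑ t, ((g : X → Fin K → ℝ) (x t) ⬝ᵥ l t) :=
    le_ciInf fun g => by linarith [h g.1 g.2]
  rw [Algorithm.regret]
  linarith

/-- If the covering numbers are trivial at a scale `ε`, the class has diameter at most `2 * ε`. -/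
theorem norm_sub_le_of_seqEntropy_eq_zero {T : ℕ} (t : Fin T) {ε : ℝ}
    (h : seqEntropy ε G T = 0) {g g' : X → Fin K → ℝ} (hg : g ∈ G) (hg' : g' ∈ G) (x : X) :
    ‖g x - g' x‖ ≤ 2 * ε := by
  obtain ⟨m, u, hu, hm⟩ := exists_finite_cover (h ▸ ENNReal.zero_ne_top)
    (fun _ _ => x : Tree X T)
  obtain ⟨_, ⟨i, rfl⟩, hi⟩ := hu g hg fun _ => true
  obtain ⟨_, ⟨i', rfl⟩, hi'⟩ := hu g' hg' fun _ => true
  -- Zero entropy leaves a single tree, which is then ε-close to both functions along the path.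
  have hm1 : m ≤ 1 := by
    by_contra! hlt
    rw [h, ENNReal.toReal_zero] at hm
    exact absurd (Real.log_pos (by exact_mod_cast hlt)) (not_lt.2 hm)
  have : Subsingleton (Fin m) := Fin.subsingleton_iff_le_one.2 hm1
  rw [Subsingleton.elim i' i] at hi'
  have h1 := hi t
  have h2 := hi' t
  simp only [Tree.val] at h1 h2
  rw [norm_sub_rev] at h2
  calc ‖g x - g' x‖ ≤ _ := norm_sub_le_norm_sub_add_norm_sub _ _ _
    _ ≤ 2 * ε := by rw [two_mul]; exact add_le_add h1 h2

/-- A class of vanishing entropy just above the scale `α` is played by any of its members. -/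
theorem exists_algorithm_of_lintegral_eq_zero (T : ℕ) (hG : G.Nonempty)
    (hGS : ∀ g ∈ G, ∀ x, g x ∈ S) {α β : ℝ} (hα : 0 < α) (hαβ : α < β)
    (hint : ∫⁻ ε in Set.Icc α β, (seqEntropy ε G T) ^ (1 / 2 : ℝ) = 0) :
    ∃ p : Algorithm X S, ∀ (x : Fin T → X) (l : Fin T → Fin K → ℝ),
      p.regret G x l ≤ 4 * α * ∑ t, l1norm (l t) := by
  obtain ⟨g₀, hg₀⟩ := hG
  refine ⟨fun _ _ x => ⟨Measure.dirac ⟨g₀ x, hGS g₀ hg₀ x⟩, inferInstance⟩, fun x l => ?_⟩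
  have hanti : Antitone fun ε => (seqEntropy ε G T) ^ (1 / 2 : ℝ) := fun a b hab =>
    ENNReal.rpow_le_rpow (seqEntropy_antitone G T hab) (by norm_num)
  -- Any scale in (α, β] has zero entropy; one below 2α as well gives diameter at most 4α.
  set ε := min β (2 * α) with hε
  have hαε : α < ε := lt_min hαβ (by linarith)
  have h0 : seqEntropy ε G T = 0 := by
    have h1 : (seqEntropy ε G T) ^ (1 / 2 : ℝ) * volume (Set.Ioc α ε) ≤ 0 := by
      rw [← hint, ← setLIntegral_const]
      exact (setLIntegral_mono' measurableSet_Ioc fun s hs => hanti hs.2).trans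
        (lintegral_mono_set (Set.Ioc_subset_Icc_self.trans
          (Set.Icc_subset_Icc_right (min_le_left _ _))))
    rw [nonpos_iff_eq_zero, mul_eq_zero, Real.volume_Ioc, ENNReal.ofReal_eq_zero] at h1
    rcases h1 with h1 | h1
    · exact (ENNReal.rpow_eq_zero_iff_of_pos (by norm_num)).1 h1
    · linarith
  refine regret_le ⟨g₀, hg₀⟩ fun g hg => ?_
  rw [Finset.mul_sum, ← Finset.sum_add_distrib]
  refine Finset.sum_le_sum fun t _ => ?_
  change ∫ s : S, (s : Fin K → ℝ) ⬝ᵥ l t ∂(Measure.dirac (⟨g₀ (x t), hGS g₀ hg₀ (x t)⟩ : S)) ≤ _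
  rw [integral_dirac' _ _ (measurable_dotProduct _).stronglyMeasurable]
  have h2 := (abs_le.1 (abs_dotProduct_sub_le (g₀ (x t)) (g (x t)) (l t))).2
  have h3 := mul_le_mul_of_nonneg_right (norm_sub_le_of_seqEntropy_eq_zero t h0 hg₀ hg (x t))
    (l1norm_nonneg (l t))
  have h4 : 2 * ε * l1norm (l t) ≤ 4 * α * l1norm (l t) :=
    mul_le_mul_of_nonneg_right (by linarith [min_le_right β (2 * α)]) (l1norm_nonneg (l t))
  dsimp only at *
  linarith

theorem coe_le_coe_ennreal {r : ℝ} {b : ℝ≥0∞} (h : b ≠ ⊤ → r ≤ b.toReal) : (r : EReal) ≤ b := by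
  rcases eq_or_ne b ⊤ with rfl | hb
  · simp
  · rw [← ENNReal.ofReal_toReal hb, EReal.coe_ennreal_ofReal]
    exact EReal.coe_le_coe_iff.2 ((h hb).trans (le_max_left _ _))

end Final

end FullInfo

/-! ### Choice of parameters and conclusion. -/

theorem theorem1 {X : Type*} (K T : ℕ) (S L : Set (Fin K → ℝ)) (G : Set (X → Fin K → ℝ))
    (R B η lam α β : ℝ)
    (hS : ∀ s ∈ S, ∀ a, 0 ≤ s a) (hL : ∀ l ∈ L, ∀ a, 0 ≤ l a)
    (hG : G.Nonempty) (hGS : ∀ g ∈ G, ∀ x, g x ∈ S)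
    (hR : 0 < R) (hB : 0 < B)
    (hLR : ∀ l ∈ L, FullInfo.l1norm l ≤ R) (hSB : ∀ s ∈ S, ‖s‖ ≤ B)
    (hη₀ : 0 < η) (hη₁ : η ≤ 1) (hlam : 0 < lam) (hα : 0 < α) (hαβ : α < β) :
    ∃ p : FullInfo.Algorithm X S,
      ∀ (x : Fin T → X) (l : Fin T → Fin K → ℝ), (∀ t, l t ∈ L) →
        ((p.regret G x l : ℝ) : EReal) ≤
          ((ENNReal.ofReal (2 * η / (R * B) * p.localNorm x l)
            + ENNReal.ofReal (4 * R * B / η) * FullInfo.seqEntropy (β / 2) G T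
            + ENNReal.ofReal (3 * Real.exp 1 ^ 2 * α * ∑ t, FullInfo.l1norm (l t))
            + ENNReal.ofReal (24 * Real.exp 1 *
                (lam / (4 * R) * ∑ t, FullInfo.l1norm (l t) ^ 2 + R / lam))
              * ∫⁻ ε in Set.Icc α β, (FullInfo.seqEntropy ε G T) ^ (1 / 2 : ℝ) : ℝ≥0∞) : EReal) := by
  have he : 2.7 < Real.exp 1 := by linarith [Real.exp_one_gt_d9]
  have he2 : 8 ≤ 3 * Real.exp 1 ^ 2 := by nlinarith
  have hN : ∀ l : Fin T → Fin K → ℝ, 0 ≤ ∑ t, FullInfo.l1norm (l t) := fun l =>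
    Finset.sum_nonneg fun t _ => FullInfo.l1norm_nonneg _
  have hQ : ∀ l : Fin T → Fin K → ℝ, 0 ≤ ∑ t, FullInfo.l1norm (l t) ^ 2 := fun l =>
    Finset.sum_nonneg fun t _ => sq_nonneg _
  set I := ∫⁻ ε in Set.Icc α β, (FullInfo.seqEntropy ε G T) ^ (1 / 2 : ℝ) with hI
  -- The general argument loses Tδ > 0, paid from the integral term, so a vanishing integral needs
  -- its own algorithm.
  by_cases hI0 : I = 0
  · obtain ⟨p, hp⟩ := FullInfo.exists_algorithm_of_lintegral_eq_zero T hG hGS hα hαβ hI0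
    refine ⟨p, fun x l hl => FullInfo.coe_le_coe_ennreal fun hb => ?_⟩
    refine ((hp x l).trans ?_).trans (ENNReal.toReal_mono hb (le_add_right le_add_self))
    rw [ENNReal.toReal_ofReal (by have := hN l; positivity), mul_assoc, mul_assoc _ α]
    exact mul_le_mul_of_nonneg_right (by linarith) (mul_nonneg hα.le (hN l))
  by_cases hfin : FullInfo.seqEntropy (β / 2) G T = ⊤ ∨ I = ⊤
  · have hplay : Nonempty (FullInfo.Algorithm X S) := by
      obtain ⟨g, hg⟩ := hG
      exact ⟨fun _ _ x => ⟨Measure.dirac ⟨g x, hGS g hg x⟩, inferInstance⟩⟩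
    refine ⟨hplay.some, fun x l hl => FullInfo.coe_le_coe_ennreal fun hb => ?_⟩
    refine absurd ?_ hb
    rcases hfin with h | h
    · have : 0 < 4 * R * B / η := by positivity
      rw [h, ENNReal.mul_top (by simpa using this)]
      simp
    · have : 0 < 24 * Real.exp 1 *
          (lam / (4 * R) * ∑ t, FullInfo.l1norm (l t) ^ 2 + R / lam) := by
        have := hQ l
        positivity
      rw [h, ENNReal.mul_top (by simpa using this)]
      simp
  push Not at hfin
  obtain ⟨hroot, hItop⟩ := hfin
  have hIpos : 0 < I.toReal := ENNReal.toReal_pos hI0 hItop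
  set H := (FullInfo.seqEntropy (β / 2) G T).toReal with hH
  have hH0 : 0 ≤ H := ENNReal.toReal_nonneg
  set c := 2 * η / (R * B) with hc
  have hcpos : 0 < c := by positivity
  -- c · RB = 2η, so η ≤ 1 is the condition for the deflated loss to be 1-Lipschitz.
  have hcM : c * (R * B) ≤ 2 := by
    rw [hc, div_mul_cancel₀ _ (by positivity)]
    linarith
  have hκ : 0 < lam / R := by positivity
  -- The rounds lose at most (R/λ)I in total, raising the coefficient from 24 to 25, which is below
  -- 24e.
  set δ := R / lam * I.toReal / (T + 1) with hδ
  have hδpos : 0 < δ := by positivity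
  obtain ⟨p, hp⟩ := FullInfo.exists_algorithm T hS hL hG hGS hB.le hLR hSB hcpos.le
    (ρ := fun l => 8 * α * FullInfo.l1norm l + 6 * (lam / R) * I.toReal * FullInfo.l1norm l ^ 2)
    (P := 8 * α * R + 6 * (lam / R) * I.toReal * R ^ 2)
    (by
      intro l hl
      have h1 := FullInfo.l1norm_nonneg l
      have h2 := hLR l hl
      rw [abs_of_nonneg (by positivity)]
      gcongr) hδpos
  refine ⟨p, fun x l hl => FullInfo.coe_le_coe_ennreal fun hb => ?_⟩
  have hLN := FullInfo.localNorm_nonneg p x l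
  have hNl := hN l
  have hQl := hQ l
  rw [ENNReal.toReal_add (fun h => hb (by rw [h, top_add])) (ENNReal.mul_ne_top ENNReal.ofReal_ne_top hItop),
    ENNReal.toReal_add (ENNReal.add_ne_top.2 ⟨ENNReal.ofReal_ne_top,
      ENNReal.mul_ne_top ENNReal.ofReal_ne_top hroot⟩) ENNReal.ofReal_ne_top,
    ENNReal.toReal_add ENNReal.ofReal_ne_top (ENNReal.mul_ne_top ENNReal.ofReal_ne_top hroot),
    ENNReal.toReal_mul, ENNReal.toReal_mul, ENNReal.toReal_ofReal (by positivity),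
    ENNReal.toReal_ofReal (by positivity), ENNReal.toReal_ofReal (by positivity),
    ENNReal.toReal_ofReal (by positivity), ← hH]
  refine FullInfo.regret_le hG fun g hg => ?_
  have h1 := hp x l hl g hg
  have h2 := FullInfo.gameValue_le T hS hL hGS hB.le hR.le hLR hSB hcpos hcM hα hαβ hκ hroot hItop
    (I := I.toReal) rfl
  rw [← hH] at h2
  have h3 : 2 * H / c ≤ 4 * R * B / η * H := by
    have : 2 * H / c = R * B / η * H := by
      rw [hc]; field_simp
    rw [this]
    gcongr
    nlinarith [mul_pos hR hB]
  have h4 : 24 * I.toReal / (lam / R) = 24 * (R / lam * I.toReal) := by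
    field_simp
  have h5 : T * δ ≤ R / lam * I.toReal := by
    rw [hδ, mul_div_assoc', div_le_iff₀ (by positivity)]
    have : 0 ≤ R / lam * I.toReal := by positivity
    nlinarith
  have h6 : ∑ t, (8 * α * FullInfo.l1norm (l t)
      + 6 * (lam / R) * I.toReal * FullInfo.l1norm (l t) ^ 2)
      = 8 * α * ∑ t, FullInfo.l1norm (l t)
        + 6 * (lam / R) * I.toReal * ∑ t, FullInfo.l1norm (l t) ^ 2 := by
    rw [Finset.mul_sum, Finset.mul_sum, ← Finset.sum_add_distrib]
  rw [h6] at h1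
  have h7 : 8 * α * ∑ t, FullInfo.l1norm (l t)
      ≤ 3 * Real.exp 1 ^ 2 * α * ∑ t, FullInfo.l1norm (l t) := by gcongr
  have h8 : 24 * Real.exp 1 * (lam / (4 * R) * ∑ t, FullInfo.l1norm (l t) ^ 2 + R / lam) * I.toReal
      = Real.exp 1 * (6 * (lam / R) * I.toReal * ∑ t, FullInfo.l1norm (l t) ^ 2)
        + 24 * Real.exp 1 * (R / lam * I.toReal) := by
    field_simp
    ring
  have h9 : 6 * (lam / R) * I.toReal * ∑ t, FullInfo.l1norm (l t) ^ 2
      ≤ Real.exp 1 * (6 * (lam / R) * I.toReal * ∑ t, FullInfo.l1norm (l t) ^ 2) :=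
    le_mul_of_one_le_left (by positivity) (by linarith)
  have h10 : 25 * (R / lam * I.toReal) ≤ 24 * Real.exp 1 * (R / lam * I.toReal) :=
    mul_le_mul_of_nonneg_right (by linarith) (by positivity)
  rw [h8]
  linarith
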